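/- Let $K\subset\mathbb{R}^3$ be a nonempty compact convex set of constant width $a>0$: for every unit vector $u$ one has $p(u)+p(-u)=a$, where $p(u)=\sup_{x\in K}\langle x,u\rangle$ is the support function of $K$. Let $r$ be the inradius of $K$ (the largest radius of a ball contained in $K$), $R$ its circumradius (the smallest radius of a ball containing $K$), and $c=r/R$. For $P\notin K$ let $\Omega(P)\subset S^2$ be the set of unit vectors $u$ such that the ray $\{P+tu: t\ge 0\}$ meets $K$, and let $|\Omega(P)|$ be its surface area, normalized so that $|S^2|=4\pi$. Then $P\mapsto|\Omega(P)|^2$ is integrable over $\mathbb{R}^3\setminus K$ with respect to Lebesgue measure, and $$4\pi^{3}a^{3}\left(\frac{8}{3}\,\frac{c^{3}}{(1+c)^{3}}-\frac{1}{6}\right)\;\le\;\int_{P\notin K}|\Omega(P)|^{2}\,dP\;\le\;4\pi^{3}a^{3}\,\frac{11-3c(3c^{2}+c-3)}{6(1+c)^{3}}.$$ Both inequalities are equalities if $K$ is a ball. Moreover, the lower bound is nonnegative if and only if $c\ge c_0:=\dfrac{1}{\sqrt[3]{16}-1}$, and $0.657<c_0<0.658$. -/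

import Mathlib

open MeasureTheory Metric

noncomputable section

namespace ConvexSpace

/-- Euclidean three-space. -/
abbrev E3 : Type := EuclideanSpace ℝ (Fin 3)

/-- The support function `p(u) = sup {⟪x, u⟫ | x ∈ K}` of `K`. -/
def supportFunction (K : Set E3) (u : E3) : ℝ :=
  sSup ((fun x : E3 => inner ℝ x u) '' K)

/-- `K` has constant width `a`: in every unit direction `u`, the two support planes of `K`
orthogonal to `u` are at distance `p(u) + p(-u) = a`. -/
def HasConstantWidth (K : Set E3) (a : ℝ) : Prop :=
  ∀ u : E3, ‖u‖ = 1 → supportFunction K u + supportFunction K (-u) = a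

/-- The inradius of `K`: the largest radius of a ball contained in `K`. -/
def inradius (K : Set E3) : ℝ :=
  sSup {ρ : ℝ | 0 ≤ ρ ∧ ∃ x : E3, closedBall x ρ ⊆ K}

/-- The circumradius of `K`: the smallest radius of a ball containing `K`. -/
def circumradius (K : Set E3) : ℝ :=
  sInf {ρ : ℝ | 0 ≤ ρ ∧ ∃ x : E3, K ⊆ closedBall x ρ}

/-- The visual solid angle `Ω(P)` of `K` from `P`: the unit directions `u` such that the ray
`P + t u`, `t ≥ 0`, meets `K`. -/
def visualSolidAngle (K : Set E3) (P : E3) : Set (sphere (0 : E3) 1) :=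
  {u | ∃ t : ℝ, 0 ≤ t ∧ P + t • (u : E3) ∈ K}

/-- The surface area `|Ω(P)|` of the visual solid angle. Here `volume.toSphere` is the usual
(unnormalized) surface measure of the unit sphere, of total mass `4π`. -/
def solidAngleArea (K : Set E3) (P : E3) : ℝ :=
  (volume : Measure E3).toSphere.real (visualSolidAngle K P)

end ConvexSpace

end

/-! The integral is compared with that of two balls. For a ball of radius `ρ`, let `f_ρ`
(`ballLineArea`) be the solid angle of the ball at outer points and the constant `2π` on the ball.
In polar coordinates `∫ f_ρ² = 32π³ρ³/3` over all of space, half of it coming from the ball itself.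

The solid angle is monotone in the body, and at a point off `K` it is at most `2π` by separation. If
`K` lies in a ball of radius `R`, then `|Ω| ≤ f_R` off `K` while `f_R = 2π` on `K`. If `K` contains
a ball of radius `r`, then `f_r ≤ |Ω|` off `K` and `f_r ≤ 2π` on `K`. With `V` the volume of `K`,
this gives `32π³r³/3 - 4π²V ≤ ∫ |Ω|² ≤ 32π³R³/3 - 4π²V`. For constant width `r + R = a`, so `c/(1+c)
= r/a`, and it remains to bound `V` on both sides.

The isodiametric inequality `V ≤ πa³/6`, obtained by Steiner symmetrization, yields exactly the
stated lower bound.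

For the upper bound, a ball of radius `r` in `K` gives `3V ≥ r S`, where `S` is the surface area,
and by Cauchy's formula `S` is controlled by the areas of the plane shadows. Each shadow again has
constant width `a`, and its area is at least `πam/2` when it contains a disc of radius `m`, by the
same argument one dimension lower. Here `m` can be `r`, or `a(1 - 1/√3)` by Jung's theorem in the
plane. Hence `V ≥ (2π/3) a r max(r, a(1 - 1/√3))`. Jung's theorem in space, `R ≤ √(3/8) a`, confines
`r/R` to a range where this suffices (`cubic_le_four_mul`).

For a ball `c = 1`, where the two bounds coincide, so equality is automatic. -/

namespace ConvexSpace

open Set Filter Topology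
open scoped Pointwise RealInnerProductSpace ENNReal

/-! ### Jung's theorem -/

section Jung

variable {E : Type*} [NormedAddCommGroup E] [InnerProductSpace ℝ E]

/-- Jung's inequality for finitely many points. -/
theorem exists_dist_sq_le_of_fintype {ι : Type*} [Fintype ι] [Nonempty ι] (x : ι → E) {a : ℝ}
    (hx : ∀ i j, ‖x i - x j‖ ≤ a) :
    ∃ c : E, ∀ i, ‖x i - c‖ ^ 2 ≤ a ^ 2 / 2 * (1 - 1 / Fintype.card ι) := by
  classical
  -- `q l` is the variance of the points under the weights `l`. The barycentre of a
  -- variance-maximizing weight will be the centre.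
  set q : (ι → ℝ) → ℝ := fun l => ∑ i, l i * ‖x i‖ ^ 2 - ‖∑ i, l i • x i‖ ^ 2 with hq
  have hcont : Continuous q := by fun_prop
  obtain ⟨l, hl, hmax⟩ := (isCompact_stdSimplex ℝ ι).exists_isMaxOn
    ⟨_, single_mem_stdSimplex ℝ (Classical.arbitrary ι)⟩ hcont.continuousOn
  obtain ⟨hl0, hl1⟩ := hl
  set c : E := ∑ i, l i • x i with hc
  set A : ℝ := ∑ i, l i * ‖x i‖ ^ 2 with hA
  have hql : q l = A - ‖c‖ ^ 2 := rfl
  have hxc : ∀ j, ‖x j - c‖ ^ 2 ≤ q l := by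
    intro j
    -- First-order optimality: moving mass `t` from `l` to the vertex `j` cannot increase the
    -- variance. Dividing by `t` and letting `t → 0` bounds the distance from `x j` to the
    -- barycentre.
    have key : ∀ t ∈ Ioc (0 : ℝ) 1, ‖x j - c‖ ^ 2 - q l ≤ t * ‖x j - c‖ ^ 2 := by
      intro t ht
      have hmem : (1 - t) • l + t • Pi.single j (1 : ℝ) ∈ stdSimplex ℝ ι :=
        convex_stdSimplex ℝ ι ⟨hl0, hl1⟩ (single_mem_stdSimplex ℝ j)
          (by linarith [ht.2]) ht.1.le (by ring)
      have h1 : q ((1 - t) • l + t • Pi.single j (1 : ℝ)) ≤ q l := hmax hmem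
      have h2 : ∑ i, ((1 - t) • l + t • Pi.single j (1 : ℝ) : ι → ℝ) i * ‖x i‖ ^ 2
          = (1 - t) * A + t * ‖x j‖ ^ 2 := by
        simp only [Pi.add_apply, Pi.smul_apply, smul_eq_mul, add_mul, Finset.sum_add_distrib,
          mul_assoc, ← Finset.mul_sum]
        simp [Pi.single_apply, hA]
      have h3 : ∑ i, ((1 - t) • l + t • Pi.single j (1 : ℝ) : ι → ℝ) i • x i
          = c + t • (x j - c) := by
        simp only [Pi.add_apply, Pi.smul_apply, smul_eq_mul, add_smul, Finset.sum_add_distrib,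
          mul_smul, ← Finset.smul_sum]
        simp only [Pi.single_apply, ite_smul, one_smul, zero_smul, Finset.sum_ite_eq',
          Finset.mem_univ, if_true, ← hc]
        module
      have h4 : ‖c + t • (x j - c)‖ ^ 2
          = ‖c‖ ^ 2 + 2 * t * ⟪c, x j - c⟫ + t ^ 2 * ‖x j - c‖ ^ 2 := by
        rw [norm_add_sq_real, inner_smul_right, norm_smul, mul_pow, Real.norm_eq_abs, sq_abs]
        ring
      have h5 : ‖x j‖ ^ 2 = ‖c‖ ^ 2 + 2 * ⟪c, x j - c⟫ + ‖x j - c‖ ^ 2 := by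
        rw [← norm_add_sq_real]; simp
      simp only [hq] at h1
      rw [h2, h3, h4] at h1
      have h6 : t * (‖x j - c‖ ^ 2 - q l) ≤ t * (t * ‖x j - c‖ ^ 2) := by
        rw [hql]
        change _ ≤ A - ‖c‖ ^ 2 at h1
        rw [h5] at h1
        linarith
      exact le_of_mul_le_mul_left h6 ht.1
    have hlim : Tendsto (fun t : ℝ => t * ‖x j - c‖ ^ 2) (𝓝[>] 0) (𝓝 (0 * ‖x j - c‖ ^ 2)) :=
      ((continuous_id.mul continuous_const).tendsto 0).mono_left nhdsWithin_le_nhds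
    have := ge_of_tendsto hlim (by
      filter_upwards [Ioc_mem_nhdsGT (zero_lt_one' ℝ)] with t ht using key t ht)
    linarith
  refine ⟨c, fun i => (hxc i).trans ?_⟩
  have hj : ∀ j, ∑ i, l i * ‖x i - x j‖ ^ 2 = q l + ‖x j - c‖ ^ 2 := by
    intro j
    have h1 : ∀ i, l i * ‖x i - x j‖ ^ 2
        = l i * ‖x i‖ ^ 2 - 2 * ⟪l i • x i, x j⟫ + l i * ‖x j‖ ^ 2 := by
      intro i
      rw [norm_sub_sq_real, real_inner_smul_left]; ring
    simp only [h1, Finset.sum_add_distrib, Finset.sum_sub_distrib, ← Finset.mul_sum,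
      ← sum_inner, ← Finset.sum_mul, hl1, ← hc, ← hA]
    rw [hql, norm_sub_sq_real, real_inner_comm]; ring
  have hle : ∀ j, ∑ i, l i * ‖x i - x j‖ ^ 2 ≤ a ^ 2 * (1 - l j) := by
    intro j
    have h1 : ∀ i ∈ Finset.univ, l i * ‖x i - x j‖ ^ 2 ≤ l i * (a ^ 2 * (if i = j then 0 else 1)) := by
      intro i _
      refine mul_le_mul_of_nonneg_left ?_ (hl0 i)
      split_ifs with h
      · simp [h]
      · simpa using pow_le_pow_left₀ (norm_nonneg _) (hx i j) 2
    refine (Finset.sum_le_sum h1).trans (le_of_eq ?_)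
    have h2 : ∀ i, l i * (a ^ 2 * (if i = j then (0 : ℝ) else 1))
        = a ^ 2 * (l i - if i = j then l i else 0) := by
      intro i; split_ifs <;> ring
    simp only [h2, ← Finset.mul_sum, Finset.sum_sub_distrib, hl1]
    simp
  -- Twice the variance is the mean squared distance of two independent points. The diagonal terms
  -- vanish, which saves the factor `1 - ∑ l j ^ 2`.
  have h2q : 2 * q l = ∑ j, l j * ∑ i, l i * ‖x i - x j‖ ^ 2 := by
    have h1 : ∑ j, l j * ‖x j - c‖ ^ 2 = q l := by
      have h2 : ∀ j, l j * ‖x j - c‖ ^ 2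
        = l j * ‖x j‖ ^ 2 - 2 * ⟪l j • x j, c⟫ + l j * ‖c‖ ^ 2 := by
        intro i
        rw [norm_sub_sq_real, real_inner_smul_left]; ring
      simp only [h2, Finset.sum_add_distrib, Finset.sum_sub_distrib, ← Finset.mul_sum,
        ← sum_inner, ← Finset.sum_mul, hl1, ← hc, ← hA]
      rw [hql, real_inner_self_eq_norm_sq]; ring
    simp only [hj, mul_add, Finset.sum_add_distrib, h1, ← Finset.sum_mul, hl1]
    ring
  have hsum : ∑ j, l j * ∑ i, l i * ‖x i - x j‖ ^ 2 ≤ a ^ 2 * (1 - ∑ j, l j ^ 2) := by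
    calc _ ≤ ∑ j, l j * (a ^ 2 * (1 - l j)) :=
          Finset.sum_le_sum fun j _ => mul_le_mul_of_nonneg_left (hle j) (hl0 j)
      _ = _ := by
          have : ∀ j, l j * (a ^ 2 * (1 - l j)) = a ^ 2 * (l j - l j ^ 2) := fun j => by ring
          simp only [this, ← Finset.mul_sum, Finset.sum_sub_distrib, hl1]
  have hcs : 1 / (Fintype.card ι : ℝ) ≤ ∑ j, l j ^ 2 := by
    have := sq_sum_le_card_mul_sum_sq (s := Finset.univ) (f := l)
    rw [hl1, Finset.card_univ] at this
    rw [div_le_iff₀ (by exact_mod_cast Fintype.card_pos)]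
    linarith
  nlinarith [sq_nonneg a]

/-- **Jung's theorem**. -/
theorem exists_subset_closedBall_of_diam_le [FiniteDimensional ℝ E] {K : Set E} {a ρ : ℝ}
    (hK : ∀ x ∈ K, ∀ y ∈ K, ‖x - y‖ ≤ a) (hρ : 0 ≤ ρ)
    (haρ : a ^ 2 / 2 * (1 - 1 / (Module.finrank ℝ E + 1)) ≤ ρ ^ 2) :
    ∃ c, K ⊆ closedBall c ρ := by
  -- A centre is a common point of the balls of radius `ρ` about the points of `K`. By Helly it
  -- suffices to treat at most `finrank + 1` of them, and the finite bound increases with the number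
  -- of points.
  have h : (⋂ i : K, closedBall (i : E) ρ).Nonempty := by
    refine Convex.helly_theorem_compact' (𝕜 := ℝ) (fun i => convex_closedBall _ _)
      (fun i => isCompact_closedBall _ _) fun I hI => ?_
    rcases I.eq_empty_or_nonempty with rfl | hne
    · exact ⟨0, by simp⟩
    · have : Nonempty I := hne.to_subtype
      obtain ⟨c, hc⟩ := exists_dist_sq_le_of_fintype (fun i : I => ((i : K) : E)) (a := a)
        fun i j => hK _ i.1.2 _ j.1.2
      refine ⟨c, ?_⟩
      simp only [mem_iInter, mem_closedBall]
      intro i hi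
      have h1 := hc ⟨i, hi⟩
      rw [dist_comm, dist_eq_norm]
      refine (sq_le_sq₀ (norm_nonneg _) hρ).1 (h1.trans (le_trans ?_ haρ))
      refine mul_le_mul_of_nonneg_left ?_ (by positivity)
      have : (Fintype.card I : ℝ) ≤ Module.finrank ℝ E + 1 := by
        rw [Fintype.card_coe]; exact_mod_cast hI
      have h0 : (0 : ℝ) < Fintype.card I := by exact_mod_cast Fintype.card_pos
      have := one_div_le_one_div_of_le h0 this
      linarith
  obtain ⟨c, hc⟩ := h
  refine ⟨c, fun x hx => ?_⟩
  have := mem_iInter.1 hc ⟨x, hx⟩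
  rwa [mem_closedBall, dist_comm] at this

end Jung

/-! ### Bodies of constant width and their inner and outer balls -/

section Width

variable {E : Type*} [NormedAddCommGroup E] [InnerProductSpace ℝ E]

/-- `K` has diameter at most `a` and width at least `a` in every direction. -/
structure IsConstantWidth (K : Set E) (a : ℝ) : Prop where
  diam_le : ∀ x ∈ K, ∀ y ∈ K, ‖x - y‖ ≤ a
  exists_inner_ge : ∀ u : E, ‖u‖ = 1 → ∃ x ∈ K, ∃ y ∈ K, a ≤ ⟪x - y, u⟫

/-- If `z` is outside `K`, separate it by a hyperplane with normal `w`. In that direction `K` stops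
short of `z` on one side and of the boundary of the outer ball on the other, so its width would be
less than `ρ + (a - ρ) = a`. -/
theorem IsConstantWidth.closedBall_subset [CompleteSpace E] {K : Set E} {a ρ : ℝ} {c : E}
    (h : IsConstantWidth K a) (hconv : Convex ℝ K) (hclosed : IsClosed K) (hne : K.Nonempty)
    (hK : K ⊆ closedBall c ρ) : closedBall c (a - ρ) ⊆ K := by
  intro z hz
  by_contra hzK
  obtain ⟨f, s, hfz, hfK⟩ := geometric_hahn_banach_point_closed hconv hclosed hzK
  set w := (InnerProductSpace.toDual ℝ E).symm f with hw
  have hfw : ∀ y, f y = ⟪w, y⟫ := fun y => by simp [hw]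
  have hw0 : w ≠ 0 := by
    intro h0
    obtain ⟨k, hk⟩ := hne
    have h1 := hfK k hk
    rw [hfw, h0, inner_zero_left] at h1 hfz
    linarith
  have hw0' : 0 < ‖w‖ := norm_pos_iff.2 hw0
  obtain ⟨x, hx, y, hy, hxy⟩ := h.exists_inner_ge (‖w‖⁻¹ • w) (by simp [norm_smul, hw0])
  rw [real_inner_smul_right, inv_mul_eq_div, le_div_iff₀ hw0'] at hxy
  have h1 := hfK y hy
  have h2 := hK hx
  rw [mem_closedBall, dist_eq_norm] at h2 hz
  rw [hfw] at hfz h1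
  have h3 := abs_real_inner_le_norm w (x - c)
  have h4 := abs_real_inner_le_norm w (z - c)
  have h5 := le_abs_self ⟪w, x - c⟫
  have h6 := neg_abs_le ⟪w, z - c⟫
  rw [real_inner_comm] at hxy
  simp only [inner_sub_right] at *
  nlinarith

/-- The point of the inner ball diametrically opposite to `k` is at distance `‖k - c‖ + ρ` from `k`,
and the diameter is at most `a`. -/
theorem IsConstantWidth.subset_closedBall {K : Set E} {a ρ : ℝ} {c : E}
    (h : IsConstantWidth K a) (hρ : 0 ≤ ρ) (hρa : ρ ≤ a) (hK : closedBall c ρ ⊆ K) :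
    K ⊆ closedBall c (a - ρ) := by
  intro k hk
  rw [mem_closedBall, dist_eq_norm]
  rcases eq_or_ne k c with rfl | hkc
  · simpa using hρa
  have h0 : 0 < ‖k - c‖ := norm_pos_iff.2 (sub_ne_zero.2 hkc)
  have h1 := h.diam_le k hk (c - (ρ / ‖k - c‖) • (k - c)) (hK (by
    rw [mem_closedBall, dist_eq_norm, sub_sub_cancel_left, norm_neg, norm_smul, Real.norm_eq_abs,
      abs_of_nonneg (by positivity)]
    exact (div_mul_cancel₀ _ h0.ne').le))
  have h2 : k - (c - (ρ / ‖k - c‖) • (k - c)) = (1 + ρ / ‖k - c‖) • (k - c) := by module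
  rw [h2, norm_smul, Real.norm_eq_abs, abs_of_nonneg (by positivity), add_mul,
    div_mul_cancel₀ _ h0.ne'] at h1
  linarith

/-- Orthogonal projections of sets of constant width have constant width. -/
theorem IsConstantWidth.image_orthogonalProjection {K : Set E} {a : ℝ} (h : IsConstantWidth K a)
    (F : Submodule ℝ E) [F.HasOrthogonalProjection] :
    IsConstantWidth (F.orthogonalProjectionOnto '' K) a where
  diam_le := by
    rintro _ ⟨x, hx, rfl⟩ _ ⟨y, hy, rfl⟩
    rw [← map_sub]
    exact (F.norm_orthogonalProjectionOnto_apply_le _).trans (h.diam_le x hx y hy)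
  exists_inner_ge := by
    intro u hu
    obtain ⟨x, hx, y, hy, hxy⟩ := h.exists_inner_ge (u : E) (by simpa using hu)
    refine ⟨_, ⟨x, hx, rfl⟩, _, ⟨y, hy, rfl⟩, ?_⟩
    rw [← map_sub, real_inner_comm]
    change a ≤ ⟪(u : E), (F.orthogonalProjectionOnto (x - y) : E)⟫
    rw [real_inner_comm] at hxy
    rwa [← Submodule.starProjection_apply, ← Submodule.inner_starProjection_left_eq_right,
      Submodule.starProjection_eq_self_iff.2 u.2]

end Width

/-! ### Fubini along a line and its orthogonal hyperplane -/

section Split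

variable {E : Type*} [NormedAddCommGroup E] [InnerProductSpace ℝ E] [FiniteDimensional ℝ E]
  [MeasurableSpace E] [BorelSpace E]

/-- The decomposition of a Euclidean space into a hyperplane and its normal line. -/
noncomputable def orthLineEquiv (v : E) (hv : ‖v‖ = 1) : (ℝ ∙ v)ᗮ × ℝ ≃ᵐ E :=
  (MeasurableEquiv.prodComm.trans
    ((LinearIsometryEquiv.toSpanUnitSingleton (𝕜 := ℝ) v hv).toMeasurableEquiv.prodCongr
      (MeasurableEquiv.refl _))).trans
  ((MeasurableEquiv.toLp 2 _).trans (ℝ ∙ v).orthogonalDecomposition.symm.toMeasurableEquiv)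

theorem orthLineEquiv_apply (v : E) (hv : ‖v‖ = 1) (p : (ℝ ∙ v)ᗮ × ℝ) :
    orthLineEquiv v hv p = (p.1 : E) + p.2 • v := by
  simp [orthLineEquiv, MeasurableEquiv.prodCongr, MeasurableEquiv.prodComm, add_comm]

theorem measurePreserving_orthLineEquiv (v : E) (hv : ‖v‖ = 1) :
    MeasurePreserving (orthLineEquiv v hv) := by
  have h1 : MeasurePreserving (MeasurableEquiv.prodComm : (ℝ ∙ v)ᗮ × ℝ ≃ᵐ ℝ × (ℝ ∙ v)ᗮ) :=
    Measure.measurePreserving_swap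
  have h2 : MeasurePreserving
      ((LinearIsometryEquiv.toSpanUnitSingleton (𝕜 := ℝ) v hv).toMeasurableEquiv.prodCongr
      (MeasurableEquiv.refl (ℝ ∙ v)ᗮ)) :=
    (LinearIsometryEquiv.measurePreserving
      (LinearIsometryEquiv.toSpanUnitSingleton (𝕜 := ℝ) v hv)).prod
      (MeasurePreserving.id (volume : Measure (ℝ ∙ v)ᗮ))
  have h3 : MeasurePreserving (MeasurableEquiv.toLp 2 ((ℝ ∙ v) × (ℝ ∙ v)ᗮ)) :=
    WithLp.volume_preserving_toLp _ _
  exact (h1.trans h2).trans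
    (h3.trans (LinearIsometryEquiv.measurePreserving (ℝ ∙ v).orthogonalDecomposition.symm))

end Split

section Split

variable {E : Type*} [NormedAddCommGroup E] [InnerProductSpace ℝ E]

theorem norm_orthogonal_add_smul_sq {v : E} (hv : ‖v‖ = 1) (y : (ℝ ∙ v)ᗮ) (t : ℝ) :
    ‖(y : E) + t • v‖ ^ 2 = ‖y‖ ^ 2 + t ^ 2 := by
  have h : ⟪(y : E), v⟫ = 0 := by
    rw [real_inner_comm]; exact Submodule.mem_orthogonal_singleton_iff_inner_right.1 y.2
  rw [norm_add_sq_real, inner_smul_right, h, norm_smul, hv]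
  simp

theorem inner_orthogonal_add_smul {v : E} (hv : ‖v‖ = 1) (y : (ℝ ∙ v)ᗮ) (t : ℝ) :
    ⟪(y : E) + t • v, v⟫ = t := by
  have h : ⟪(y : E), v⟫ = 0 := by
    rw [real_inner_comm]; exact Submodule.mem_orthogonal_singleton_iff_inner_right.1 y.2
  rw [inner_add_left, real_inner_smul_left, h, real_inner_self_eq_norm_sq, hv]
  simp

theorem finrank_orthogonal_singleton {v : E} (hv : ‖v‖ = 1) {n : ℕ}
    (hn : Module.finrank ℝ E = n + 1) : Module.finrank ℝ (ℝ ∙ v)ᗮ = n := by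
  have : Fact (Module.finrank ℝ E = n + 1) := ⟨hn⟩
  exact Submodule.finrank_orthogonal_span_singleton (norm_ne_zero_iff.1 (by simp [hv]))

variable [MeasurableSpace E] [BorelSpace E]

theorem measurable_orthogonal_add_smul (v : E) :
    Measurable fun p : (ℝ ∙ v)ᗮ × ℝ => (p.1 : E) + p.2 • v := by
  have : Continuous fun p : (ℝ ∙ v)ᗮ × ℝ => (p.1 : E) + p.2 • v := by fun_prop
  exact this.measurable

variable [FiniteDimensional ℝ E]

theorem volume_eq_prod_orth {v : E} (hv : ‖v‖ = 1) (A : Set E) :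
    volume A = volume {p : (ℝ ∙ v)ᗮ × ℝ | (p.1 : E) + p.2 • v ∈ A} := by
  rw [← (measurePreserving_orthLineEquiv v hv).measure_preimage_equiv]
  congr 1
  ext p
  simp [orthLineEquiv_apply]


theorem volume_eq_lintegral_lines {v : E} (hv : ‖v‖ = 1) {A : Set E} (hA : MeasurableSet A) :
    volume A = ∫⁻ y : (ℝ ∙ v)ᗮ, volume {t : ℝ | (y : E) + t • v ∈ A} := by
  rw [volume_eq_prod_orth hv, Measure.volume_eq_prod,
    Measure.prod_apply (show MeasurableSet {p : (ℝ ∙ v)ᗮ × ℝ | (p.1 : E) + p.2 • v ∈ A} from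
      measurable_orthogonal_add_smul v hA)]
  rfl

theorem volume_eq_lintegral_hyperplanes {v : E} (hv : ‖v‖ = 1) {A : Set E}
    (hA : MeasurableSet A) :
    volume A = ∫⁻ t : ℝ, volume {y : (ℝ ∙ v)ᗮ | (y : E) + t • v ∈ A} := by
  rw [volume_eq_prod_orth hv, Measure.volume_eq_prod,
    Measure.prod_apply_symm (show MeasurableSet {p : (ℝ ∙ v)ᗮ × ℝ | (p.1 : E) + p.2 • v ∈ A} from
      measurable_orthogonal_add_smul v hA)]
  rfl

end Split

/-! ### Area of a spherical cap -/

section Cap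

theorem volume_ball_of_finrank_two {F : Type*} [NormedAddCommGroup F] [InnerProductSpace ℝ F]
    [FiniteDimensional ℝ F] [MeasurableSpace F] [BorelSpace F] (hF : Module.finrank ℝ F = 2)
    (x : F) {r : ℝ} (hr : 0 ≤ r) : volume (ball x r) = ENNReal.ofReal (Real.pi * r ^ 2) := by
  have : Nontrivial F := Module.nontrivial_of_finrank_pos (R := ℝ) (by omega)
  rw [InnerProductSpace.volume_ball_of_dim_even (k := 1) (by omega), hF,
    ← ENNReal.ofReal_pow hr, ← ENNReal.ofReal_mul (by positivity)]
  congr 1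
  simp [mul_comm]

theorem volume_closedBall_of_finrank_two {F : Type*} [NormedAddCommGroup F]
    [InnerProductSpace ℝ F]
    [FiniteDimensional ℝ F] [MeasurableSpace F] [BorelSpace F] (hF : Module.finrank ℝ F = 2)
    (x : F) {r : ℝ} (hr : 0 ≤ r) :
    volume (closedBall x r) = ENNReal.ofReal (Real.pi * r ^ 2) := by
  have : Nontrivial F := Module.nontrivial_of_finrank_pos (R := ℝ) (by omega)
  rw [Measure.addHaar_closedBall_eq_addHaar_ball, volume_ball_of_finrank_two hF x hr]

theorem finrank_E3 : Module.finrank ℝ E3 = 3 := by simp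

theorem volume_sector {v : E3} (hv : ‖v‖ = 1) {h : ℝ} (h0 : 0 < h) (h1 : h < 1) :
    volume {x : E3 | 0 < ‖x‖ ∧ ‖x‖ < 1 ∧ h * ‖x‖ ≤ ⟪x, v⟫}
      = ENNReal.ofReal (2 * Real.pi / 3 * (1 - h)) := by
  have hF : Module.finrank ℝ (ℝ ∙ v)ᗮ = 2 := finrank_orthogonal_singleton hv finrank_E3
  have hmeas : MeasurableSet {x : E3 | 0 < ‖x‖ ∧ ‖x‖ < 1 ∧ h * ‖x‖ ≤ ⟪x, v⟫} := by
    have hn : Measurable fun x : E3 => ‖x‖ := measurable_norm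
    have hi : Measurable fun x : E3 => ⟪x, v⟫ := (by fun_prop : Continuous _).measurable
    exact (measurableSet_lt measurable_const hn).inter
      ((measurableSet_lt hn measurable_const).inter (measurableSet_le (hn.const_mul h) hi))
  -- `k` is the squared tangent of the half-angle. The slice at height `t` is the disc of the cone,
  -- of radius `√k * t`, until the cone meets the sphere at `t = h`, and the disc of the ball from
  -- there on.
  set k : ℝ := 1 / h ^ 2 - 1 with hk
  have hk0 : 0 ≤ k := by
    rw [hk, sub_nonneg, le_div_iff₀ (by positivity)]; nlinarith
  have hkh : h ^ 2 * (k + 1) = 1 := by rw [hk]; field_simp; ring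
  have hslice : ∀ t : ℝ, volume {y : (ℝ ∙ v)ᗮ | (y : E3) + t • v ∈
      {x : E3 | 0 < ‖x‖ ∧ ‖x‖ < 1 ∧ h * ‖x‖ ≤ ⟪x, v⟫}}
      = (Ioo 0 h).indicator (fun t => ENNReal.ofReal (Real.pi * (k * t ^ 2))) t
        + (Ico h 1).indicator (fun t => ENNReal.ofReal (Real.pi * (1 - t ^ 2))) t := by
    intro t
    have hset : {y : (ℝ ∙ v)ᗮ | (y : E3) + t • v ∈
        {x : E3 | 0 < ‖x‖ ∧ ‖x‖ < 1 ∧ h * ‖x‖ ≤ ⟪x, v⟫}}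
        = {y : (ℝ ∙ v)ᗮ | 0 < t ∧ ‖y‖ ^ 2 < 1 - t ^ 2 ∧ ‖y‖ ^ 2 ≤ k * t ^ 2} := by
      ext y
      simp only [mem_ofPred_eq, inner_orthogonal_add_smul hv]
      have hn := norm_orthogonal_add_smul_sq hv y t
      set m := ‖(y : E3) + t • v‖ with hm
      have hm0 : 0 ≤ m := norm_nonneg _
      constructor
      · rintro ⟨a1, a2, a3⟩
        have ht : 0 < t := lt_of_lt_of_le (by positivity) a3
        refine ⟨ht, by nlinarith, ?_⟩
        have : h ^ 2 * m ^ 2 ≤ t ^ 2 := by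
          rw [← mul_pow]; exact pow_le_pow_left₀ (by positivity) a3 2
        rw [hn] at this
        have h2 : h ^ 2 * ‖y‖ ^ 2 ≤ h ^ 2 * (k * t ^ 2) := by nlinarith
        exact le_of_mul_le_mul_left h2 (by positivity)
      · rintro ⟨ht, a2, a3⟩
        have hmpos : 0 < m := by
          rcases hm0.eq_or_lt with h' | h'
          · rw [← h'] at hn; nlinarith [sq_nonneg ‖y‖]
          · exact h'
        refine ⟨hmpos, by nlinarith, ?_⟩
        refine (sq_le_sq₀ (by positivity) ht.le).1 ?_
        rw [mul_pow, hn]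
        have h2 : h ^ 2 * ‖y‖ ^ 2 ≤ h ^ 2 * (k * t ^ 2) :=
          mul_le_mul_of_nonneg_left a3 (by positivity)
        nlinarith
    rw [hset]
    rcases le_or_gt t 0 with ht | ht
    · rw [indicator_of_notMem (fun hh => (hh.1.trans_le ht).false),
        indicator_of_notMem (fun hh => (h0.trans_le (hh.1.trans ht)).false)]
      simp [ht.not_gt]
    rcases lt_or_ge t h with hth | hth
    · rw [indicator_of_mem (show t ∈ Ioo 0 h from ⟨ht, hth⟩),
        indicator_of_notMem (fun hh => (hh.1.trans_lt hth).false), add_zero]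
      have : {y : (ℝ ∙ v)ᗮ | 0 < t ∧ ‖y‖ ^ 2 < 1 - t ^ 2 ∧ ‖y‖ ^ 2 ≤ k * t ^ 2}
          = closedBall 0 (√k * t) := by
        ext y
        rw [mem_closedBall_zero_iff, mem_ofPred_eq,
          ← sq_le_sq₀ (norm_nonneg _) (by positivity), mul_pow, Real.sq_sqrt hk0]
        refine ⟨fun hh => hh.2.2, fun hh => ⟨ht, hh.trans_lt ?_, hh⟩⟩
        have : (k + 1) * t ^ 2 < (k + 1) * h ^ 2 := by
          apply mul_lt_mul_of_pos_left _ (by positivity)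
          exact pow_lt_pow_left₀ hth ht.le two_ne_zero
        nlinarith
      rw [this, volume_closedBall_of_finrank_two hF _ (by positivity), mul_pow, Real.sq_sqrt hk0]
    · rw [indicator_of_notMem (fun hh => (hh.2.trans_le hth).false), zero_add]
      rcases lt_or_ge t 1 with ht1 | ht1
      · rw [indicator_of_mem (show t ∈ Ico h 1 from ⟨hth, ht1⟩)]
        have h2 : 0 ≤ 1 - t ^ 2 := by nlinarith
        have : {y : (ℝ ∙ v)ᗮ | 0 < t ∧ ‖y‖ ^ 2 < 1 - t ^ 2 ∧ ‖y‖ ^ 2 ≤ k * t ^ 2}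
            = ball 0 (√(1 - t ^ 2)) := by
          ext y
          rw [mem_ball_zero_iff, mem_ofPred_eq,
            ← sq_lt_sq₀ (norm_nonneg _) (by positivity), Real.sq_sqrt h2]
          refine ⟨fun hh => hh.2.1, fun hh => ⟨ht, hh, hh.le.trans ?_⟩⟩
          have : (k + 1) * h ^ 2 ≤ (k + 1) * t ^ 2 := by gcongr
          nlinarith
        rw [this, volume_ball_of_finrank_two hF _ (by positivity), Real.sq_sqrt h2]
      · rw [indicator_of_notMem (fun hh => (hh.2.trans_le ht1).false)]
        have : {y : (ℝ ∙ v)ᗮ | 0 < t ∧ ‖y‖ ^ 2 < 1 - t ^ 2 ∧ ‖y‖ ^ 2 ≤ k * t ^ 2} = ∅ := by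
          ext y
          simp only [mem_ofPred_eq, mem_empty_iff_false, iff_false, not_and]
          intro _ hh
          nlinarith [sq_nonneg ‖y‖]
        rw [this, measure_empty]
  rw [volume_eq_lintegral_hyperplanes hv hmeas]
  simp only [hslice]
  rw [lintegral_add_left ((by fun_prop : Measurable fun t : ℝ =>
      ENNReal.ofReal (Real.pi * (k * t ^ 2))).indicator measurableSet_Ioo),
    lintegral_indicator measurableSet_Ioo, lintegral_indicator measurableSet_Ico,
    ← ofReal_integral_eq_lintegral_ofReal, ← ofReal_integral_eq_lintegral_ofReal,
    ← ENNReal.ofReal_add, integral_Ico_eq_integral_Ioo, ← integral_Ioc_eq_integral_Ioo,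
    ← integral_Ioc_eq_integral_Ioo, ← intervalIntegral.integral_of_le h0.le,
    ← intervalIntegral.integral_of_le h1.le]
  · congr 1
    simp only [intervalIntegral.integral_const_mul]
    rw [intervalIntegral.integral_sub (by simp) (by simp)]
    simp only [integral_pow, intervalIntegral.integral_const]
    rw [hk]
    field_simp
    norm_num
    ring
  · exact setIntegral_nonneg measurableSet_Ioo fun t _ => by positivity
  · exact setIntegral_nonneg measurableSet_Ico fun t ht => by
      have := ht.1; have := ht.2
      exact mul_nonneg Real.pi_pos.le (by nlinarith)
  · exact (Continuous.integrableOn_Icc (by fun_prop)).mono_set Ico_subset_Icc_self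
  · filter_upwards [ae_restrict_mem measurableSet_Ico] with t ht
    have := ht.1; have := ht.2
    exact mul_nonneg Real.pi_pos.le (by nlinarith)
  · exact (Continuous.integrableOn_Icc (by fun_prop)).mono_set Ioo_subset_Icc_self
  · filter_upwards with t
    positivity

/-- The area of a spherical cap. -/
theorem toSphere_cap {v : E3} (hv : ‖v‖ = 1) {h : ℝ} (h0 : 0 < h) (h1 : h < 1) :
    (volume : Measure E3).toSphere {u | h ≤ ⟪(u : E3), v⟫}
      = ENNReal.ofReal (2 * Real.pi * (1 - h)) := by
  have hm : MeasurableSet {u : sphere (0 : E3) 1 | h ≤ ⟪(u : E3), v⟫} :=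
    measurableSet_le (by fun_prop) (by fun_prop)
  rw [Measure.toSphere_apply' _ hm]
  have : Ioo (0 : ℝ) 1 • ((↑) '' {u : sphere (0 : E3) 1 | h ≤ ⟪(u : E3), v⟫})
      = {x : E3 | 0 < ‖x‖ ∧ ‖x‖ < 1 ∧ h * ‖x‖ ≤ ⟪x, v⟫} := by
    ext x
    simp only [Set.mem_smul, mem_ofPred_eq]
    constructor
    · rintro ⟨t, ht, _, ⟨u, hu, rfl⟩, rfl⟩
      have hu1 : ‖(u : E3)‖ = 1 := norm_eq_of_mem_sphere u
      rw [norm_smul, hu1, Real.norm_eq_abs, abs_of_pos ht.1, real_inner_smul_left, mul_one,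
        mul_comm h]
      exact ⟨ht.1, ht.2, mul_le_mul_of_nonneg_left hu ht.1.le⟩
    · rintro ⟨hx, hx1, hxh⟩
      refine ⟨‖x‖, ⟨hx, hx1⟩, ‖x‖⁻¹ • x, ⟨⟨‖x‖⁻¹ • x, ?_⟩, ?_, rfl⟩, ?_⟩
      · simp [norm_smul, hx.ne']
      · change h ≤ ⟪‖x‖⁻¹ • x, v⟫
        rw [real_inner_smul_left, inv_mul_eq_div, le_div_iff₀ hx]; exact hxh
      · rw [smul_smul, mul_inv_cancel₀ hx.ne', one_smul]
  rw [this, volume_sector hv h0 h1, finrank_E3, show ((3 : ℕ) : ℝ≥0∞) = ENNReal.ofReal 3 by simp,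
    ← ENNReal.ofReal_mul (by norm_num)]
  congr 1; ring

end Cap

/-! ### The integral for a ball -/

section BallIntegral

/-- The measure of the set of lines through a point at distance `s` from the centre of a ball of
radius `ρ` that meet the ball, where the set of all lines through a point has measure `2π`. -/
noncomputable def ballLineArea (ρ s : ℝ) : ℝ :=
  if s ≤ ρ then 2 * Real.pi else 2 * Real.pi * (1 - √(1 - ρ ^ 2 / s ^ 2))

theorem ballLineArea_of_le {ρ s : ℝ} (h : s ≤ ρ) : ballLineArea ρ s = 2 * Real.pi := if_pos h

theorem ballLineArea_of_lt {ρ s : ℝ} (h : ρ < s) :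
    ballLineArea ρ s = 2 * Real.pi * (1 - √(1 - ρ ^ 2 / s ^ 2)) := if_neg h.not_ge

theorem ballLineArea_le (ρ s : ℝ) : ballLineArea ρ s ≤ 2 * Real.pi := by
  unfold ballLineArea
  split_ifs
  · rfl
  · nlinarith [Real.pi_pos, Real.sqrt_nonneg (1 - ρ ^ 2 / s ^ 2)]

theorem ballLineArea_nonneg (ρ s : ℝ) : 0 ≤ ballLineArea ρ s := by
  unfold ballLineArea
  split_ifs
  · positivity
  · have : √(1 - ρ ^ 2 / s ^ 2) ≤ 1 := Real.sqrt_le_one.2 (by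
      have : 0 ≤ ρ ^ 2 / s ^ 2 := by positivity
      linarith)
    exact mul_nonneg (by positivity) (by linarith)

theorem integral_Ioi_sq_mul_sq_one_sub_sqrt {ρ : ℝ} (hρ : 0 < ρ) :
    IntegrableOn (fun s : ℝ => s ^ 2 * (1 - √(1 - ρ ^ 2 / s ^ 2)) ^ 2) (Ioi ρ) ∧
    ∫ s in Ioi ρ, s ^ 2 * (1 - √(1 - ρ ^ 2 / s ^ 2)) ^ 2 = ρ ^ 3 / 3 := by
  -- An antiderivative with `g ρ = -ρ³/3` and limit `0` at infinity.
  set g : ℝ → ℝ := fun y =>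
    2 * y ^ 3 / 3 - ρ ^ 2 * y - 2 / 3 * ((y ^ 2 - ρ ^ 2) * √(y ^ 2 - ρ ^ 2)) with hg
  have hcont : ContinuousWithinAt g (Ici ρ) ρ := by
    apply Continuous.continuousWithinAt
    fun_prop
  have hderiv : ∀ y ∈ Ioi ρ, HasDerivAt g (y ^ 2 * (1 - √(1 - ρ ^ 2 / y ^ 2)) ^ 2) y := by
    intro y (hy : ρ < y)
    have hy0 : 0 < y := hρ.trans hy
    have hpos : 0 < y ^ 2 - ρ ^ 2 := by nlinarith
    have h1 : HasDerivAt (fun y : ℝ => y ^ 2 - ρ ^ 2) (2 * y) y := by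
      simpa using (hasDerivAt_pow 2 y).sub_const (ρ ^ 2)
    have h2 := h1.sqrt hpos.ne'
    have h3 := ((((hasDerivAt_pow 3 y).const_mul 2).div_const 3).sub
      ((hasDerivAt_id y).const_mul (ρ ^ 2))).sub ((h1.mul h2).const_mul (2 / 3))
    convert! h3 using 1
    have hs : √(1 - ρ ^ 2 / y ^ 2) = √(y ^ 2 - ρ ^ 2) / y := by
      rw [show 1 - ρ ^ 2 / y ^ 2 = (y ^ 2 - ρ ^ 2) / y ^ 2 by field_simp,
        Real.sqrt_div' _ (by positivity), Real.sqrt_sq hy0.le]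
    rw [hs]
    set w := √(y ^ 2 - ρ ^ 2) with hw
    have hw2 : w ^ 2 = y ^ 2 - ρ ^ 2 := Real.sq_sqrt hpos.le
    have hw0 : 0 < w := Real.sqrt_pos.2 hpos
    rw [← hw2]
    have hρ2 : ρ ^ 2 = y ^ 2 - w ^ 2 := by linarith
    rw [hρ2]
    field_simp
    norm_num
    ring
  have hnonneg : ∀ y ∈ Ioi ρ, 0 ≤ y ^ 2 * (1 - √(1 - ρ ^ 2 / y ^ 2)) ^ 2 :=
    fun y _ => by positivity
  have hlim : Tendsto g atTop (𝓝 0) := by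
    have h1 : Tendsto (fun y : ℝ => ρ ^ 4 / y) atTop (𝓝 0) :=
      tendsto_const_nhds.div_atTop tendsto_id
    refine squeeze_zero_norm' ?_ h1
    filter_upwards [eventually_gt_atTop ρ] with y hy
    have hy0 : 0 < y := hρ.trans hy
    have hpos : 0 < y ^ 2 - ρ ^ 2 := by nlinarith
    set w := √(y ^ 2 - ρ ^ 2) with hw
    have hw2 : w ^ 2 = y ^ 2 - ρ ^ 2 := Real.sq_sqrt hpos.le
    have hw0 : 0 < w := Real.sqrt_pos.2 hpos
    have hwy : w ≤ y := by nlinarith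
    have hρ2 : ρ ^ 2 = (y - w) * (y + w) := by linarith
    have hρ4 : ρ ^ 4 = ((y - w) * (y + w)) ^ 2 := by rw [← hρ2]; ring
    -- This factorization exposes the cancellation: `y - w = ρ² / (y + w)`, so `g` decays like
    -- `1/y`.
    have hgy : g y = - ((y - w) ^ 2 * (2 * w + y) / 3) := by
      simp only [hg, ← hw]
      rw [← hw2, hρ2]
      ring
    rw [hgy, norm_neg, Real.norm_eq_abs, abs_of_nonneg (by positivity), le_div_iff₀ hy0, hρ4]
    have h2 : (2 * w + y) / 3 * y ≤ (y + w) ^ 2 := by nlinarith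
    calc _ = (y - w) ^ 2 * ((2 * w + y) / 3 * y) := by ring
      _ ≤ (y - w) ^ 2 * (y + w) ^ 2 := by gcongr
      _ = _ := by ring
  refine ⟨integrableOn_Ioi_deriv_of_nonneg hcont hderiv hnonneg hlim, ?_⟩
  rw [integral_Ioi_of_hasDerivAt_of_nonneg hcont hderiv hnonneg hlim]
  simp only [hg, sub_self, zero_mul]
  ring

theorem integral_ballLineArea_sq {ρ : ℝ} (hρ : 0 < ρ) :
    Integrable (fun x : E3 => ballLineArea ρ ‖x‖ ^ 2) ∧
    ∫ x : E3, ballLineArea ρ ‖x‖ ^ 2 = 32 * Real.pi ^ 3 / 3 * ρ ^ 3 := by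
  obtain ⟨hint, hval⟩ := integral_Ioi_sq_mul_sq_one_sub_sqrt hρ
  have e1 : EqOn (fun y : ℝ => y ^ 2 * ballLineArea ρ y ^ 2)
      (fun y => 4 * Real.pi ^ 2 * y ^ 2) (Ioc 0 ρ) := fun y hy => by
    simp only [ballLineArea_of_le hy.2]; ring
  have e2 : EqOn (fun y : ℝ => y ^ 2 * ballLineArea ρ y ^ 2)
      (fun y => 4 * Real.pi ^ 2 * (y ^ 2 * (1 - √(1 - ρ ^ 2 / y ^ 2)) ^ 2)) (Ioi ρ) :=
    fun y hy => by
    simp only [ballLineArea_of_lt (show ρ < y from hy)]; ring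
  have i1 : IntegrableOn (fun y : ℝ => y ^ 2 * ballLineArea ρ y ^ 2) (Ioc 0 ρ) := by
    rw [integrableOn_congr_fun e1 measurableSet_Ioc]
    exact (Continuous.integrableOn_Icc (by fun_prop)).mono_set Ioc_subset_Icc_self
  have i2 : IntegrableOn (fun y : ℝ => y ^ 2 * ballLineArea ρ y ^ 2) (Ioi ρ) := by
    rw [integrableOn_congr_fun e2 measurableSet_Ioi]
    exact hint.const_mul _
  constructor
  · rw [integrable_fun_norm_addHaar volume (f := fun y => ballLineArea ρ y ^ 2), finrank_E3,
      ← Ioc_union_Ioi_eq_Ioi hρ.le]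
    exact i1.union i2
  · rw [integral_fun_norm_addHaar volume (fun y => ballLineArea ρ y ^ 2), finrank_E3,
      ← Ioc_union_Ioi_eq_Ioi hρ.le]
    simp only [smul_eq_mul, Nat.add_one_sub_one]
    rw [setIntegral_union Ioc_disjoint_Ioi_same measurableSet_Ioi i1 i2,
      setIntegral_congr_fun measurableSet_Ioc e1, setIntegral_congr_fun measurableSet_Ioi e2,
      integral_const_mul, integral_const_mul, hval, ← intervalIntegral.integral_of_le hρ.le,
      measureReal_def, EuclideanSpace.volume_ball_fin_three]
    simp only [ENNReal.ofReal_one, one_pow, one_mul, integral_pow, nsmul_eq_mul]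
    rw [ENNReal.toReal_ofReal (by positivity)]
    norm_num
    ring

end BallIntegral

/-! ### Solid angles: comparison with balls -/

section SolidAngle

theorem visualSolidAngle_mono {K L : Set E3} (h : K ⊆ L) (P : E3) :
    visualSolidAngle K P ⊆ visualSolidAngle L P :=
  fun _ ⟨t, ht, hK⟩ => ⟨t, ht, h hK⟩

theorem solidAngleArea_mono {K L : Set E3} (h : K ⊆ L) (P : E3) :
    solidAngleArea K P ≤ solidAngleArea L P :=
  measureReal_mono (visualSolidAngle_mono h P)

theorem solidAngleArea_closedBall {x P : E3} {ρ : ℝ} (hρ : 0 < ρ) (hP : ρ < ‖P - x‖) :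
    solidAngleArea (closedBall x ρ) P = ballLineArea ρ ‖P - x‖ := by
  rw [ballLineArea_of_lt hP]
  set s := ‖P - x‖ with hs
  have hs0 : 0 < s := hρ.trans hP
  have hpos : 0 < 1 - ρ ^ 2 / s ^ 2 := by
    rw [sub_pos, div_lt_one (by positivity)]; gcongr
  set h := √(1 - ρ ^ 2 / s ^ 2) with hh
  have hh2 : h ^ 2 * s ^ 2 = s ^ 2 - ρ ^ 2 := by
    rw [hh, Real.sq_sqrt hpos.le]; field_simp
  have h0 : 0 < h := Real.sqrt_pos.2 hpos
  have h1 : h < 1 := by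
    have : 0 < ρ ^ 2 := by positivity
    have : h ^ 2 * s ^ 2 < 1 * s ^ 2 := by linarith
    have := lt_of_mul_lt_mul_right this (by positivity)
    nlinarith
  have hv : ‖s⁻¹ • (x - P)‖ = 1 := by
    rw [norm_smul, norm_sub_rev, ← hs, norm_inv, Real.norm_eq_abs, abs_of_pos hs0,
      inv_mul_cancel₀ hs0.ne']
  have : visualSolidAngle (closedBall x ρ) P
      = {u : sphere (0 : E3) 1 | h ≤ ⟪(u : E3), s⁻¹ • (x - P)⟫} := by
    ext u
    have hu : ‖(u : E3)‖ = 1 := norm_eq_of_mem_sphere u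
    rw [mem_ofPred_eq, real_inner_smul_right, inv_mul_eq_div, le_div_iff₀ hs0]
    have hnorm : ∀ t : ℝ, ‖P + t • (u : E3) - x‖ ^ 2
        = s ^ 2 - 2 * t * ⟪(u : E3), x - P⟫ + t ^ 2 := by
      intro t
      rw [show P + t • (u : E3) - x = t • (u : E3) - (x - P) by abel, norm_sub_sq_real, norm_smul,
        hu, norm_sub_rev x P, ← hs, real_inner_smul_left, mul_one, Real.norm_eq_abs, sq_abs]
      ring
    set b := ⟪(u : E3), x - P⟫ with hb
    have hmem : ∀ t : ℝ, P + t • (u : E3) ∈ closedBall x ρ ↔ s ^ 2 - 2 * t * b + t ^ 2 ≤ ρ ^ 2 := by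
      intro t
      rw [mem_closedBall, dist_eq_norm, ← sq_le_sq₀ (norm_nonneg _) hρ.le, hnorm]
    constructor
    · rintro ⟨t, ht, hK⟩
      rw [hmem] at hK
      have hb0 : 0 ≤ b := by
        by_contra hb'
        nlinarith [mul_nonneg ht (neg_nonneg.2 (le_of_not_ge hb'))]
      refine (sq_le_sq₀ (by positivity) hb0).1 ?_
      rw [mul_pow, hh2]
      nlinarith [sq_nonneg (t - b)]
    · intro hb'
      have hb0 : 0 ≤ b := le_trans (by positivity) hb'
      -- The parameter `b` is the point of the ray closest to the centre.
      refine ⟨b, hb0, (hmem b).2 ?_⟩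
      have := pow_le_pow_left₀ (by positivity) hb' 2
      rw [mul_pow, hh2] at this
      nlinarith
  rw [solidAngleArea, this, measureReal_def, toSphere_cap hv h0 h1, ENNReal.toReal_ofReal]
  exact mul_nonneg (by positivity) (by linarith)

/-- A hyperplane strictly separating `P` from `K` confines the visible directions to an open
half-sphere, and by compactness to a proper cap of it. -/
theorem solidAngleArea_le_of_notMem {K : Set E3} (hK : IsCompact K) (hconv : Convex ℝ K)
    {P : E3} (hP : P ∉ K) : solidAngleArea K P ≤ 2 * Real.pi := by
  obtain ⟨f, c, hfP, hfK⟩ := geometric_hahn_banach_point_closed hconv hK.isClosed hP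
  set w := (InnerProductSpace.toDual ℝ E3).symm f with hw
  have hfw : ∀ y, f y = ⟪y, w⟫ := fun y => by rw [real_inner_comm]; simp [hw]
  have hfP' : 0 < c - f P := by linarith
  rcases K.eq_empty_or_nonempty with rfl | ⟨k, hk⟩
  · simp only [solidAngleArea, visualSolidAngle, mem_empty_iff_false, and_false, exists_const]
    simp [Real.pi_pos.le]
  have hw0 : 0 < ‖w‖ := by
    rw [norm_pos_iff]
    intro h0
    have := hfK k hk
    rw [hfw, h0, inner_zero_right] at this
    rw [hfw, h0, inner_zero_right] at hfP
    linarith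
  obtain ⟨D, hD⟩ := hK.isBounded.subset_closedBall P
  have hD0 : 0 < D := by
    have := hD hk
    rw [mem_closedBall] at this
    refine lt_of_lt_of_le (dist_pos.2 ?_) this
    rintro rfl; exact hP hk
  -- The gap to the hyperplane divided by a bound on the distance from `P` to `K`. The cutoff `1 /
  -- 2` only ensures `h < 1`.
  set h := min (((c - f P) / ‖w‖) / D) (1 / 2) with hh
  have h0 : 0 < h := lt_min (by positivity) (by norm_num)
  have h1 : h < 1 := (min_le_right _ _).trans_lt (by norm_num)
  have hv : ‖‖w‖⁻¹ • w‖ = 1 := by simp [norm_smul, hw0.ne']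
  have hsub : visualSolidAngle K P ⊆ {u | h ≤ ⟪(u : E3), ‖w‖⁻¹ • w⟫} := by
    rintro u ⟨t, ht, hu⟩
    have hu1 : ‖(u : E3)‖ = 1 := norm_eq_of_mem_sphere u
    have htD : t ≤ D := by
      have := hD hu
      rwa [mem_closedBall, dist_eq_norm, add_sub_cancel_left, norm_smul, hu1, mul_one,
        Real.norm_eq_abs, abs_of_nonneg ht] at this
    have h2 := hfK _ hu
    rw [hfw, inner_add_left, real_inner_smul_left, ← hfw] at h2
    have ht0 : 0 < t := by
      rcases ht.eq_or_lt with h' | h'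
      · rw [← h'] at h2; linarith
      · exact h'
    refine le_trans (b := ((c - f P) / ‖w‖) / D) (min_le_left _ _) ?_
    change _ ≤ ⟪(u : E3), ‖w‖⁻¹ • w⟫
    rw [real_inner_smul_right, inv_mul_eq_div, div_le_iff₀ hD0]
    have hpos : 0 < ⟪(u : E3), w⟫ := by
      by_contra hneg
      nlinarith
    rw [div_mul_eq_mul_div]
    refine div_le_div_of_nonneg_right ?_ hw0.le
    nlinarith
  calc solidAngleArea K P
      ≤ (volume : Measure E3).toSphere.real {u | h ≤ ⟪(u : E3), ‖w‖⁻¹ • w⟫} :=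
        measureReal_mono hsub
    _ = 2 * Real.pi * (1 - h) := by
      rw [measureReal_def, toSphere_cap hv h0 h1, ENNReal.toReal_ofReal]
      exact mul_nonneg (by positivity) (by linarith)
    _ ≤ _ := by nlinarith [Real.pi_pos]

/-- The pairs (point, visible direction) form a countable union of closed sets: bounding the ray
parameter by `n` makes the projection proper. -/
theorem measurable_solidAngleArea {K : Set E3} (hK : IsClosed K) :
    Measurable (solidAngleArea K) := by
  have hm : MeasurableSet {p : E3 × sphere (0 : E3) 1 | p.2 ∈ visualSolidAngle K p.1} := by
    have : {p : E3 × sphere (0 : E3) 1 | p.2 ∈ visualSolidAngle K p.1}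
        = ⋃ n : ℕ, Prod.fst '' {q : (E3 × sphere (0 : E3) 1) × Icc (0 : ℝ) n |
          q.1.1 + (q.2 : ℝ) • (q.1.2 : E3) ∈ K} := by
      ext p
      simp only [mem_ofPred_eq, mem_iUnion, mem_image, Prod.exists, exists_and_right,
        exists_eq_right]
      constructor
      · rintro ⟨t, ht, h⟩
        obtain ⟨n, hn⟩ := exists_nat_ge t
        exact ⟨n, ⟨t, ht, hn⟩, h⟩
      · rintro ⟨n, ⟨t, ht, _⟩, h⟩
        exact ⟨t, ht, h⟩
    rw [this]
    refine MeasurableSet.iUnion fun n => IsClosed.measurableSet ?_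
    have hc : Continuous fun q : (E3 × sphere (0 : E3) 1) × Icc (0 : ℝ) n =>
        q.1.1 + (q.2 : ℝ) • (q.1.2 : E3) := by fun_prop
    exact isClosedMap_fst_of_compactSpace _ (hK.preimage hc)
  exact (measurable_measure_prodMk_left hm).ennreal_toReal

/-- The function of the outer ball dominates off `K` and equals `2π` on `K`, so removing `K` costs
exactly `4π²` times its volume. -/
theorem integrableOn_solidAngleArea_sq {K : Set E3} (hK : IsCompact K) (hconv : Convex ℝ K)
    {x : E3} {ρ : ℝ} (hρ : 0 < ρ) (hsub : K ⊆ closedBall x ρ) :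
    IntegrableOn (fun P => solidAngleArea K P ^ 2) Kᶜ ∧
    ∫ P in Kᶜ, solidAngleArea K P ^ 2
      ≤ 32 * Real.pi ^ 3 / 3 * ρ ^ 3 - 4 * Real.pi ^ 2 * volume.real K := by
  obtain ⟨hint0, hval0⟩ := integral_ballLineArea_sq hρ
  have hint := hint0.comp_sub_right x
  have hval := (integral_sub_right_eq_self (μ := (volume : Measure E3))
    (fun P => ballLineArea ρ ‖P‖ ^ 2) x).trans hval0
  have hle : ∀ P ∈ Kᶜ, solidAngleArea K P ^ 2 ≤ ballLineArea ρ ‖P - x‖ ^ 2 := by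
    intro P hP
    refine pow_le_pow_left₀ measureReal_nonneg ?_ 2
    rcases le_or_gt ‖P - x‖ ρ with h | h
    · rw [ballLineArea_of_le h]; exact solidAngleArea_le_of_notMem hK hconv hP
    · rw [← solidAngleArea_closedBall hρ h]; exact solidAngleArea_mono hsub P
  have hI : IntegrableOn (fun P => solidAngleArea K P ^ 2) Kᶜ := by
    refine hint.integrableOn.mono' ((measurable_solidAngleArea hK.isClosed).pow_const
      2).aestronglyMeasurable ?_
    filter_upwards [ae_restrict_mem hK.measurableSet.compl] with P hP
    rw [Real.norm_eq_abs, abs_of_nonneg (sq_nonneg _)]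
    exact hle P hP
  refine ⟨hI, ?_⟩
  have h1 := setIntegral_mono_on hI hint.integrableOn hK.measurableSet.compl hle
  have h2 := integral_add_compl hK.measurableSet hint
  have h3 : ∫ P in K, ballLineArea ρ ‖P - x‖ ^ 2 = 4 * Real.pi ^ 2 * volume.real K := by
    have : EqOn (fun P => ballLineArea ρ ‖P - x‖ ^ 2) (fun _ => 4 * Real.pi ^ 2) K := by
      intro P hP
      have := hsub hP
      rw [mem_closedBall, dist_eq_norm] at this
      simp only [ballLineArea_of_le this]; ring
    rw [setIntegral_congr_fun hK.measurableSet this, setIntegral_const, smul_eq_mul, mul_comm]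
  linarith

/-- A point off `K` is off the inner ball, so monotonicity applies there. On `K` the ball function
is at most `2π`. -/
theorem le_integral_solidAngleArea_sq {K : Set E3} (hK : IsCompact K)
    (hI : IntegrableOn (fun P => solidAngleArea K P ^ 2) Kᶜ)
    {x : E3} {ρ : ℝ} (hρ : 0 < ρ) (hsub : closedBall x ρ ⊆ K) :
    32 * Real.pi ^ 3 / 3 * ρ ^ 3 - 4 * Real.pi ^ 2 * volume.real K
      ≤ ∫ P in Kᶜ, solidAngleArea K P ^ 2 := by
  obtain ⟨hint0, hval0⟩ := integral_ballLineArea_sq hρ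
  have hint := hint0.comp_sub_right x
  have hval := (integral_sub_right_eq_self (μ := (volume : Measure E3))
    (fun P => ballLineArea ρ ‖P‖ ^ 2) x).trans hval0
  have hle : ∀ P ∈ Kᶜ, ballLineArea ρ ‖P - x‖ ^ 2 ≤ solidAngleArea K P ^ 2 := by
    intro P hP
    refine pow_le_pow_left₀ (ballLineArea_nonneg _ _) ?_ 2
    rw [← solidAngleArea_closedBall hρ]
    · exact solidAngleArea_mono hsub P
    · by_contra h
      exact hP (hsub (by rw [mem_closedBall, dist_eq_norm]; linarith))
  have h1 := setIntegral_mono_on hint.integrableOn hI hK.measurableSet.compl hle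
  have h2 := integral_add_compl hK.measurableSet hint
  have h3 : ∫ P in K, ballLineArea ρ ‖P - x‖ ^ 2 ≤ 4 * Real.pi ^ 2 * volume.real K := by
    have := setIntegral_mono_on hint.integrableOn
      (integrableOn_const (C := 4 * Real.pi ^ 2) hK.measure_ne_top) hK.measurableSet
      (fun P _ => by
        have := pow_le_pow_left₀ (ballLineArea_nonneg _ _) (ballLineArea_le ρ ‖P - x‖) 2
        rw [mul_pow] at this; norm_num at this ⊢; exact this)
    rwa [setIntegral_const, smul_eq_mul, mul_comm] at this
  linarith

end SolidAngle

/-! ### Steiner symmetrization and the isodiametric inequality -/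

section Steiner

variable {E : Type*} [NormedAddCommGroup E] [InnerProductSpace ℝ E]

/-- Steiner symmetrization of `K` with respect to the hyperplane orthogonal to `v`. -/
def steiner (v : E) (K : Set E) : Set E :=
  {x | ENNReal.ofReal (2 * |⟪x, v⟫|) < volume {t : ℝ | x + t • v ∈ K}}

theorem volume_line_translate (v : E) (K : Set E) (x : E) (c : ℝ) :
    volume {t : ℝ | x + c • v + t • v ∈ K} = volume {t : ℝ | x + t • v ∈ K} := by
  rw [← measure_preimage_add volume c {t : ℝ | x + t • v ∈ K}]
  congr 1
  ext t
  simp [add_smul, add_assoc]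

theorem steiner_reflect_self {v : E} (hv : ‖v‖ = 1) (K : Set E) {x : E} (hx : x ∈ steiner v K) :
    x - (2 * ⟪x, v⟫) • v ∈ steiner v K := by
  have h1 : ⟪x - (2 * ⟪x, v⟫) • v, v⟫ = - ⟪x, v⟫ := by
    rw [inner_sub_left, real_inner_smul_left, real_inner_self_eq_norm_sq, hv]; ring
  simp only [steiner, mem_ofPred_eq] at hx ⊢
  rwa [h1, abs_neg, sub_eq_add_neg, ← neg_smul, volume_line_translate]

theorem steiner_reflect {v w : E} (hvw : ⟪v, w⟫ = 0) {K : Set E}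
    (hK : ∀ x ∈ K, x - (2 * ⟪x, w⟫) • w ∈ K) {x : E} (hx : x ∈ steiner v K) :
    x - (2 * ⟪x, w⟫) • w ∈ steiner v K := by
  have h1 : ⟪x - (2 * ⟪x, w⟫) • w, v⟫ = ⟪x, v⟫ := by
    rw [inner_sub_left, real_inner_smul_left, real_inner_comm v w, hvw]; simp
  simp only [steiner, mem_ofPred_eq] at hx ⊢
  rw [h1]
  refine hx.trans_le (measure_mono fun t ht => ?_)
  have := hK _ ht
  rw [inner_add_left, real_inner_smul_left, hvw, mul_zero, add_zero] at this
  rw [mem_ofPred_eq]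
  convert this using 1
  abel

/-- `B'` lies between its infimum and supremum, and `B` lies in `[sup B' - d, inf B' + d]`. These
two lengths add up to `2d`. -/
theorem volume_add_volume_le_of_dist_le {B B' : Set ℝ} (hB : B.Nonempty) (hB' : B'.Nonempty)
    {d : ℝ} (h : ∀ t ∈ B, ∀ t' ∈ B', |t - t'| ≤ d) :
    volume B + volume B' ≤ ENNReal.ofReal (2 * d) := by
  obtain ⟨t0, ht0⟩ := hB
  obtain ⟨t1, ht1⟩ := hB'
  have hd : 0 ≤ d := (abs_nonneg _).trans (h t0 ht0 t1 ht1)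
  have hbb : BddBelow B' := ⟨t0 - d, fun t' ht' => by
    have := (abs_le.1 (h t0 ht0 t' ht')).2; linarith⟩
  have hba : BddAbove B' := ⟨t0 + d, fun t' ht' => by
    have := (abs_le.1 (h t0 ht0 t' ht')).1; linarith⟩
  have hle : sInf B' ≤ sSup B' := (csInf_le hbb ht1).trans (le_csSup hba ht1)
  have hdm : sSup B' - sInf B' ≤ 2 * d := by
    have e1 : sSup B' ≤ t0 + d := csSup_le ⟨t1, ht1⟩ fun t' ht' => by
      have := (abs_le.1 (h t0 ht0 t' ht')).1; linarith
    have e2 : t0 - d ≤ sInf B' := le_csInf ⟨t1, ht1⟩ fun t' ht' => by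
      have := (abs_le.1 (h t0 ht0 t' ht')).2; linarith
    linarith
  have h1 : B' ⊆ Icc (sInf B') (sSup B') := fun t' ht' => ⟨csInf_le hbb ht', le_csSup hba ht'⟩
  have h2 : B ⊆ Icc (sSup B' - d) (sInf B' + d) := fun t ht => by
    constructor
    · rw [sub_le_iff_le_add]
      exact csSup_le ⟨t1, ht1⟩ fun t' ht' => by
        have := (abs_le.1 (h t ht t' ht')).1; linarith
    · rw [← sub_le_iff_le_add]
      exact le_csInf ⟨t1, ht1⟩ fun t' ht' => by
        have := (abs_le.1 (h t ht t' ht')).2; linarith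
  calc volume B + volume B' ≤ volume (Icc (sSup B' - d) (sInf B' + d))
        + volume (Icc (sInf B') (sSup B')) := add_le_add (measure_mono h2) (measure_mono h1)
    _ = ENNReal.ofReal (2 * d) := by
      rw [Real.volume_Icc, Real.volume_Icc, ← ENNReal.ofReal_add (by linarith) (by linarith)]
      congr 1; ring

theorem steiner_norm_sub_le {v : E} (hv : ‖v‖ = 1) {K : Set E} {a : ℝ}
    (hK : ∀ x ∈ K, ∀ y ∈ K, ‖x - y‖ ≤ a) :
    ∀ x ∈ steiner v K, ∀ x' ∈ steiner v K, ‖x - x'‖ ≤ a := by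
  intro x hx x' hx'
  simp only [steiner, mem_ofPred_eq] at hx hx'
  set s := ⟪x, v⟫ with hs
  set s' := ⟪x', v⟫ with hs'
  rw [← volume_line_translate v K x (-s)] at hx
  rw [← volume_line_translate v K x' (-s')] at hx'
  set B := {t : ℝ | x + (-s) • v + t • v ∈ K}
  set B' := {t : ℝ | x' + (-s') • v + t • v ∈ K}
  have hB : B.Nonempty := nonempty_of_measure_ne_zero (ne_zero_of_lt hx)
  have hB' : B'.Nonempty := nonempty_of_measure_ne_zero (ne_zero_of_lt hx')
  -- Otherwise the two fibres have total length at most `2|s - s'|`, whereas membership in the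
  -- symmetrized set makes it exceed `2|s| + 2|s'|`.
  have hdist : ∃ t ∈ B, ∃ t' ∈ B', |s - s'| ≤ |t - t'| := by
    by_contra! hcon
    have h1 := volume_add_volume_le_of_dist_le hB hB' fun t ht t' ht' => (hcon t ht t' ht').le
    have h2 := (ENNReal.add_lt_add hx hx').trans_le h1
    rw [← ENNReal.ofReal_add (by positivity) (by positivity)] at h2
    have h3 := (ENNReal.ofReal_lt_ofReal_iff'.1 h2).1
    have := abs_sub s s'
    linarith
  obtain ⟨t, ht, t', ht', htt⟩ := hdist
  have h1 := hK _ ht _ ht'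
  refine le_trans ?_ h1
  rw [← sq_le_sq₀ (norm_nonneg _) (norm_nonneg _)]
  set z := (x - x') - (s - s') • v with hz
  have hzv : ⟪z, v⟫ = 0 := by
    rw [hz, inner_sub_left, inner_sub_left, real_inner_smul_left, real_inner_self_eq_norm_sq, hv]
    ring
  have e : ∀ r : ℝ, ‖z + r • v‖ ^ 2 = ‖z‖ ^ 2 + r ^ 2 := fun r => by
    rw [norm_add_sq_real, inner_smul_right, hzv, norm_smul, hv]; simp
  have e1 : x - x' = z + (s - s') • v := by rw [hz]; abel
  have e2 : x + (-s) • v + t • v - (x' + (-s') • v + t' • v) = z + (t - t') • v := by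
    rw [hz]; module
  rw [e2, e1, e, e]
  exact add_le_add le_rfl (sq_le_sq.2 htt)

variable [MeasurableSpace E] [BorelSpace E]

theorem measurable_volume_line (v : E) {K : Set E} (hK : MeasurableSet K) :
    Measurable fun x : E => volume {t : ℝ | x + t • v ∈ K} := by
  have h : Continuous fun p : E × ℝ => p.1 + p.2 • v := by fun_prop
  exact measurable_measure_prodMk_left (h.measurable hK)

theorem measurableSet_steiner (v : E) {K : Set E} (hK : MeasurableSet K) :
    MeasurableSet (steiner v K) := by
  refine measurableSet_lt ?_ (measurable_volume_line v hK)
  have : Continuous fun x : E => ENNReal.ofReal (2 * |⟪x, v⟫|) :=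
    ENNReal.continuous_ofReal.comp (by fun_prop)
  exact this.measurable

theorem volume_setOf_ofReal_two_mul_abs_lt (L : ℝ≥0∞) :
    volume {t : ℝ | ENNReal.ofReal (2 * |t|) < L} = L := by
  induction L with
  | top =>
    rw [eq_univ_of_forall (s := {t : ℝ | ENNReal.ofReal (2 * |t|) < ∞})
      fun t => ENNReal.ofReal_lt_top, Real.volume_univ]
  | coe L =>
    have : {t : ℝ | ENNReal.ofReal (2 * |t|) < L} = Ioo (-(L / 2 : ℝ)) (L / 2) := by
      ext t
      rw [mem_ofPred_eq, ENNReal.ofReal_lt_coe_iff (by positivity), mem_Ioo, ← abs_lt,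
        lt_div_iff₀ two_pos, mul_comm]
    rw [this, Real.volume_Ioo, sub_neg_eq_add, add_halves, ENNReal.ofReal_coe_nnreal]

variable [FiniteDimensional ℝ E]

theorem volume_steiner {v : E} (hv : ‖v‖ = 1) {K : Set E} (hK : MeasurableSet K) :
    volume (steiner v K) = volume K := by
  rw [volume_eq_lintegral_lines hv (measurableSet_steiner v hK), volume_eq_lintegral_lines hv hK]
  congr 1
  ext y
  simp only [steiner, mem_ofPred_eq, inner_orthogonal_add_smul hv, volume_line_translate]
  exact volume_setOf_ofReal_two_mul_abs_lt _

/-- The **isodiametric inequality** in three-space. -/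
theorem volume_le_of_norm_sub_le {K : Set E3} (hK : MeasurableSet K) {a : ℝ} (ha : 0 ≤ a)
    (hdiam : ∀ x ∈ K, ∀ y ∈ K, ‖x - y‖ ≤ a) :
    volume K ≤ ENNReal.ofReal (Real.pi * a ^ 3 / 6) := by
  set b := EuclideanSpace.basisFun (Fin 3) ℝ with hb
  have hn : ∀ i, ‖b i‖ = 1 := b.orthonormal.1
  have ho : ∀ i j, i ≠ j → ⟪b i, b j⟫ = 0 := fun i j h => b.orthonormal.2 h
  set K0 := steiner (b 0) K
  set K1 := steiner (b 1) K0
  set K2 := steiner (b 2) K1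
  have m0 : MeasurableSet K0 := measurableSet_steiner _ hK
  have m1 : MeasurableSet K1 := measurableSet_steiner _ m0
  have m2 : MeasurableSet K2 := measurableSet_steiner _ m1
  have hvol : volume K2 = volume K := by
    rw [volume_steiner (hn 2) m1, volume_steiner (hn 1) m0, volume_steiner (hn 0) hK]
  have hd : ∀ x ∈ K2, ∀ y ∈ K2, ‖x - y‖ ≤ a :=
    steiner_norm_sub_le (hn 2) (steiner_norm_sub_le (hn 1) (steiner_norm_sub_le (hn 0) hdiam))
  have r0 : ∀ x ∈ K2, x - (2 * ⟪x, b 0⟫) • b 0 ∈ K2 := fun x hx =>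
    steiner_reflect (ho 2 0 (by decide)) (fun x hx =>
      steiner_reflect (ho 1 0 (by decide)) (fun x hx => steiner_reflect_self (hn 0) _ hx) hx) hx
  have r1 : ∀ x ∈ K2, x - (2 * ⟪x, b 1⟫) • b 1 ∈ K2 := fun x hx =>
    steiner_reflect (ho 2 1 (by decide)) (fun x hx => steiner_reflect_self (hn 1) _ hx) hx
  have r2 : ∀ x ∈ K2, x - (2 * ⟪x, b 2⟫) • b 2 ∈ K2 := fun x hx =>
    steiner_reflect_self (hn 2) _ hx
  -- `-x` is the product of the three coordinate reflections. A later symmetrization preserves the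
  -- earlier symmetries because the directions are orthogonal.
  have hneg : ∀ x ∈ K2, -x ∈ K2 := by
    intro x hx
    have := r2 _ (r1 _ (r0 x hx))
    convert this using 1
    simp only [inner_sub_left, real_inner_smul_left, ho 0 1 (by decide), ho 0 2 (by decide),
      ho 1 2 (by decide), mul_zero, sub_zero]
    have hsum : ∑ i, ⟪x, b i⟫ • b i = x := by
      simpa only [real_inner_comm] using b.sum_repr' x
    rw [Fin.sum_univ_three] at hsum
    nth_rewrite 1 [← hsum]
    nth_rewrite 4 [← hsum]
    module
  have hsub : K2 ⊆ closedBall 0 (a / 2) := by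
    intro x hx
    have := hd x hx (-x) (hneg x hx)
    rw [sub_neg_eq_add, ← two_smul ℝ, norm_smul] at this
    rw [mem_closedBall_zero_iff]
    norm_num at this
    linarith
  rw [← hvol]
  refine (measure_mono hsub).trans (le_of_eq ?_)
  rw [EuclideanSpace.volume_closedBall_fin_three, ← ENNReal.ofReal_pow (by positivity),
    ← ENNReal.ofReal_mul (by positivity)]
  congr 1; ring

end Steiner

/-! ### Volume growth under adding a zonotope -/

section Zonotope

variable {E : Type*} [NormedAddCommGroup E] [InnerProductSpace ℝ E]

/-- The segment from `-w • u` to `w • u`. -/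
def symmSegment (u : E) (w : ℝ) : Set E := (fun t : ℝ => t • u) '' Icc (-w) w

theorem zero_mem_symmSegment (u : E) {w : ℝ} (hw : 0 ≤ w) : (0 : E) ∈ symmSegment u w :=
  ⟨0, ⟨by linarith, hw⟩, zero_smul _ _⟩

theorem isCompact_symmSegment (u : E) (w : ℝ) : IsCompact (symmSegment u w) :=
  isCompact_Icc.image (by fun_prop)

theorem convex_symmSegment (u : E) (w : ℝ) : Convex ℝ (symmSegment u w) :=
  (convex_Icc (-w) w).linear_image (LinearMap.toSpanSingleton ℝ E u)

theorem smul_mem_sum_symmSegment {ι : Type*} {s : Finset ι} {u : ι → E} {w : ι → ℝ} {e : ℝ}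
    {z : E} (hz : z ∈ ∑ i ∈ s, symmSegment (u i) (e * w i)) (he : 0 < e) :
    e⁻¹ • z ∈ ∑ i ∈ s, symmSegment (u i) (w i) := by
  rw [Set.mem_finsetSum] at hz ⊢
  obtain ⟨g, hg, rfl⟩ := hz
  refine ⟨fun i => e⁻¹ • g i, fun {i} hi => ?_, by rw [Finset.smul_sum]⟩
  obtain ⟨t, ht, hti⟩ := hg hi
  refine ⟨e⁻¹ * t, ⟨?_, ?_⟩, ?_⟩
  · rw [le_inv_mul_iff₀ he]; linarith [ht.1]
  · rw [inv_mul_le_iff₀ he]; exact ht.2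
  · simp only [mul_smul] at hti ⊢
    rw [← hti]

/-- The sum in `h` is the support function of the zonotope at `v`. It is tested at `v = z/‖z‖`. -/
theorem norm_le_one_of_mem_sum_symmSegment {ι : Type*} {s : Finset ι} {u : ι → E} {w : ι → ℝ}
    (h : ∀ v : E, ‖v‖ = 1 → ∑ i ∈ s, w i * |⟪u i, v⟫| ≤ 1)
    {z : E} (hz : z ∈ ∑ i ∈ s, symmSegment (u i) (w i)) : ‖z‖ ≤ 1 := by
  rcases eq_or_ne z 0 with rfl | hz0
  · simp
  have hzn : 0 < ‖z‖ := norm_pos_iff.2 hz0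
  have h1 := h (‖z‖⁻¹ • z) (by simp [norm_smul, hz0])
  refine le_trans ?_ h1
  have h2 : ‖z‖ = ⟪z, ‖z‖⁻¹ • z⟫ := by
    rw [real_inner_smul_right, real_inner_self_eq_norm_sq]; field_simp
  generalize ‖z‖⁻¹ • z = v at h1 h2 ⊢
  rw [h2]
  rw [Set.mem_finsetSum] at hz
  obtain ⟨g, hg, rfl⟩ := hz
  rw [sum_inner]
  refine Finset.sum_le_sum fun i hi => ?_
  obtain ⟨t, ht, hti⟩ := hg hi
  rw [← hti, real_inner_smul_left]
  calc t * ⟪u i, v⟫ ≤ |t * ⟪u i, v⟫| := le_abs_self _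
    _ = |t| * |⟪u i, v⟫| := abs_mul _ _
    _ ≤ _ := mul_le_mul_of_nonneg_right (abs_le.2 ht) (abs_nonneg _)

variable [FiniteDimensional ℝ E] [MeasurableSpace E] [BorelSpace E]

/-- Every fibre over the shadow of `K` is a compact interval, which the segment lengthens by `w` at
each end. -/
theorem volume_add_symmSegment_ge {K : Set E} (hK : IsCompact K) (hconv : Convex ℝ K)
    {v : E} (hv : ‖v‖ = 1) {w : ℝ} (hw : 0 ≤ w) :
    volume K + ENNReal.ofReal (2 * w) * volume ((ℝ ∙ v)ᗮ.orthogonalProjectionOnto '' K)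
      ≤ volume (K + symmSegment v w) := by
  have hKs : IsCompact (K + symmSegment v w) := hK.add (isCompact_symmSegment v w)
  have hproj : IsCompact ((ℝ ∙ v)ᗮ.orthogonalProjectionOnto '' K) :=
    hK.image (ContinuousLinearMap.continuous _)
  rw [volume_eq_lintegral_lines hv hK.measurableSet, volume_eq_lintegral_lines hv hKs.measurableSet,
    ← lintegral_indicator_const hproj.measurableSet,
    ← lintegral_add_right _ (measurable_const.indicator hproj.measurableSet)]
  refine lintegral_mono fun y => ?_
  by_cases hy : y ∈ (ℝ ∙ v)ᗮ.orthogonalProjectionOnto '' K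
  · rw [indicator_of_mem hy]
    set B := {t : ℝ | (y : E) + t • v ∈ K} with hB
    have hBne : B.Nonempty := by
      obtain ⟨x, hx, rfl⟩ := hy
      refine ⟨⟪v, x⟫, ?_⟩
      have : ((ℝ ∙ v)ᗮ.orthogonalProjectionOnto x : E) + ⟪v, x⟫ • v = x := by
        rw [← Submodule.starProjection_apply, Submodule.starProjection_orthogonal_val,
          Submodule.starProjection_unit_singleton ℝ hv, sub_add_cancel]
      rw [hB, mem_ofPred_eq, this]
      exact hx
    have hBclosed : IsClosed B := hK.isClosed.preimage (by fun_prop)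
    have hBbdd : Bornology.IsBounded B := by
      obtain ⟨D, hD⟩ := hK.isBounded.subset_closedBall 0
      refine isBounded_closedBall (x := (0 : ℝ)) (r := D) |>.subset fun t ht => ?_
      have h1 := hD ht
      rw [mem_closedBall_zero_iff] at h1 ⊢
      have h2 := norm_orthogonal_add_smul_sq hv y t
      have h3 : ‖t‖ ^ 2 ≤ ‖(y : E) + t • v‖ ^ 2 := by
        rw [h2, Real.norm_eq_abs, sq_abs]; nlinarith [sq_nonneg ‖y‖]
      exact ((sq_le_sq₀ (norm_nonneg _) (norm_nonneg _)).1 h3).trans h1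
    have hBc : IsCompact B := Metric.isCompact_of_isClosed_isBounded hBclosed hBbdd
    have hm := hBc.sInf_mem hBne
    have hM := hBc.sSup_mem hBne
    set m := sInf B
    set M := sSup B
    have hmM : m ≤ M := csInf_le hBbdd.bddBelow hM
    have hsub : B ⊆ Icc m M := fun t ht => ⟨csInf_le hBbdd.bddBelow ht, le_csSup hBbdd.bddAbove ht⟩
    have hconvB : Icc m M ⊆ B := by
      have hBconv : Convex ℝ B := by
        intro t ht t' ht' α β hα hβ hαβ
        have := hconv ht ht' hα hβ hαβ
        rw [hB, mem_ofPred_eq]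
        convert this using 1
        rw [smul_add, smul_add, add_add_add_comm, ← add_smul, hαβ, one_smul, smul_smul, smul_smul,
          ← add_smul, smul_eq_mul, smul_eq_mul]
      exact hBconv.ordConnected.out hm hM
    calc volume B + ENNReal.ofReal (2 * w) ≤ volume (Icc m M) + ENNReal.ofReal (2 * w) := by
          gcongr
      _ = volume (Icc (m - w) (M + w)) := by
          rw [Real.volume_Icc, Real.volume_Icc, ← ENNReal.ofReal_add (by linarith) (by linarith)]
          congr 1; ring
      _ ≤ _ := by
          refine measure_mono fun t ht => ?_
          set t' := max m (min t M) with ht'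
          have h1 : t' ∈ Icc m M := ⟨le_max_left _ _, max_le hmM (min_le_right _ _)⟩
          have h2 : t - t' ∈ Icc (-w) w := by
            rcases le_total t M with h | h
            · rcases le_total m t with h' | h'
              · rw [ht', min_eq_left h, max_eq_right h']; constructor <;> linarith
              · rw [ht', min_eq_left h, max_eq_left h']; constructor <;> linarith [ht.1]
            · rw [ht', min_eq_right h, max_eq_right hmM]; constructor <;> linarith [ht.2]
          refine Set.mem_add.2 ⟨_, hconvB h1, _, ⟨t - t', h2, rfl⟩, ?_⟩
          module
  · rw [indicator_of_notMem hy, add_zero]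
    refine measure_mono fun t ht => ?_
    exact Set.mem_add.2 ⟨_, ht, 0, zero_mem_symmSegment v hw, add_zero _⟩

/-- The segments are added one at a time. Shadows only grow in the process, so the bound `A`
persists. -/
theorem volume_add_sum_symmSegment_ge {ι : Type*} (s : Finset ι) (u : ι → E) (w : ι → ℝ)
    (hu : ∀ i ∈ s, ‖u i‖ = 1) (hw : ∀ i ∈ s, 0 ≤ w i) (A : ℝ≥0∞) :
    ∀ K : Set E, IsCompact K → Convex ℝ K →
      (∀ v : E, ‖v‖ = 1 → A ≤ volume ((ℝ ∙ v)ᗮ.orthogonalProjectionOnto '' K)) →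
      volume K + ENNReal.ofReal (2 * ∑ i ∈ s, w i) * A
        ≤ volume (K + ∑ i ∈ s, symmSegment (u i) (w i)) := by
  classical
  induction s using Finset.induction_on with
  | empty => intro K _ _ _; simp
  | insert i s hi ih =>
    intro K hK hconv hA
    have hui := hu i (Finset.mem_insert_self _ _)
    have hwi := hw i (Finset.mem_insert_self _ _)
    have hws : ∀ j ∈ s, 0 ≤ w j := fun j hj => hw j (Finset.mem_insert_of_mem hj)
    rw [Finset.sum_insert hi, Finset.sum_insert hi, ← add_assoc K, mul_add,
      ENNReal.ofReal_add (by positivity) (mul_nonneg two_pos.le (Finset.sum_nonneg hws)), add_mul,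
      ← add_assoc]
    refine le_trans ?_ (ih (fun j hj => hu j (Finset.mem_insert_of_mem hj)) hws _
      (hK.add (isCompact_symmSegment (u i) (w i))) (hconv.add (convex_symmSegment (u i) (w i)))
      fun v hv => (hA v hv).trans (measure_mono (image_mono fun x hx =>
        Set.mem_add.2 ⟨x, hx, 0, zero_mem_symmSegment _ hwi, add_zero _⟩)))
    gcongr
    refine le_trans ?_ (volume_add_symmSegment_ge hK hconv hui hwi)
    gcongr
    exact hA _ hui

/-- If `K` contains a ball of radius `ρ`, then its volume is bounded below in terms of the areas of
its projections and of any zonotope contained in the unit ball. -/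
theorem le_finrank_mul_volume_of_zonotope {ι : Type*} (s : Finset ι) (u : ι → E) (w : ι → ℝ)
    (hu : ∀ i ∈ s, ‖u i‖ = 1) (hw : ∀ i ∈ s, 0 ≤ w i)
    (h : ∀ v : E, ‖v‖ = 1 → ∑ i ∈ s, w i * |⟪u i, v⟫| ≤ 1)
    {K : Set E} (hK : IsCompact K) (hconv : Convex ℝ K) {x : E} {ρ : ℝ} (hρ : 0 < ρ)
    (hball : closedBall x ρ ⊆ K) {A : ℝ} (hA0 : 0 ≤ A)
    (hA : ∀ v : E, ‖v‖ = 1 →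
      ENNReal.ofReal A ≤ volume ((ℝ ∙ v)ᗮ.orthogonalProjectionOnto '' K)) :
    2 * ρ * (∑ i ∈ s, w i) * A ≤ Module.finrank ℝ E * volume.real K := by
  set n := Module.finrank ℝ E with hn
  set V := volume.real K with hV
  set W := ∑ i ∈ s, w i with hW
  have hW0 : 0 ≤ W := Finset.sum_nonneg hw
  have key : ∀ e : ℝ, 0 < e → V + 2 * e * ρ * W * A ≤ (1 + e) ^ n * V := by
    intro e he
    have h1 := volume_add_sum_symmSegment_ge s u (fun i => (e * ρ) * w i) hu
      (fun i hi => mul_nonneg (by positivity) (hw i hi)) _ K hK hconv hA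
    -- The scaled zonotope lies in `e • (K - x)`, and `K + e • K = (1 + e) • K` by convexity.
    have h2 : K + ∑ i ∈ s, symmSegment (u i) ((e * ρ) * w i) ⊆
        (fun y => -(e • x) + y) '' ((1 + e) • K) := by
      rintro _ ⟨k, hk, z, hz, rfl⟩
      have h3 := norm_le_one_of_mem_sum_symmSegment h (smul_mem_sum_symmSegment hz (by positivity))
      rw [norm_smul, Real.norm_eq_abs, abs_of_pos (by positivity), inv_mul_le_iff₀ (by positivity),
        mul_one] at h3
      have h4 : x + e⁻¹ • z ∈ K := hball (by
        rw [mem_closedBall, dist_eq_norm, add_sub_cancel_left, norm_smul, Real.norm_eq_abs,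
          abs_of_pos (by positivity), inv_mul_le_iff₀ he]
        exact h3)
      have h5 := hconv hk h4 (a := 1 / (1 + e)) (b := e / (1 + e)) (by positivity) (by positivity)
        (by field_simp)
      refine ⟨_, Set.smul_mem_smul_set (a := 1 + e) h5, ?_⟩
      simp only [smul_add, smul_smul]
      rw [mul_div_cancel₀ _ (by positivity), mul_div_cancel₀ _ (by positivity),
        show (1 + e) * (e / (1 + e) * e⁻¹) = 1 by field_simp, one_smul, one_smul]
      abel
    have h3 := h1.trans (measure_mono h2)
    rw [image_add_left, measure_preimage_add, Measure.addHaar_smul, ← Finset.mul_sum, ← hW, ← hn,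
      ← ENNReal.ofReal_mul (by positivity), abs_of_pos (by positivity),
      ← ofReal_measureReal hK.measure_ne_top, ← hV, ← ENNReal.ofReal_add measureReal_nonneg
        (by positivity), ← ENNReal.ofReal_mul (by positivity)] at h3
    rw [ENNReal.ofReal_le_ofReal_iff (by positivity)] at h3
    linarith
  -- The two sides of `key` agree at `e = 0`, so comparing slopes there gives the claim.
  have hder : HasDerivAt (fun e : ℝ => (1 + e) ^ n * V) (n * V) 0 := by
    have := ((((hasDerivAt_id (0 : ℝ)).const_add 1).pow n).mul_const V)
    simpa using this
  have hlim := hder.tendsto_slope_zero_right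
  refine ge_of_tendsto hlim ?_
  filter_upwards [self_mem_nhdsWithin] with e he
  have he' : 0 < e := he
  have := key e he'
  rw [smul_eq_mul, le_inv_mul_iff₀ he']
  simp
  linarith

end Zonotope

/-! ### Passage from zonotopes to the ball: a Cauchy-type inequality -/

section Sphere

variable {E : Type*} [NormedAddCommGroup E] [InnerProductSpace ℝ E] [FiniteDimensional ℝ E]
  [MeasurableSpace E] [BorelSpace E]

/-- This is `n V ≥ ρ S` combined with Cauchy's surface area formula, where `κ` is twice the volume
of the unit ball one dimension lower. Discretizing the surface measure of the sphere produces
zonotopes in the unit ball, so no notion of surface area of `K` is needed. -/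
theorem le_finrank_mul_volume_of_projections [Nontrivial E] {κ : ℝ}
    (hκ : ∀ v : E, ‖v‖ = 1 →
      ∫ u : sphere (0 : E) 1, |⟪(u : E), v⟫| ∂(volume : Measure E).toSphere = κ)
    {K : Set E} (hK : IsCompact K) (hconv : Convex ℝ K) {x : E} {ρ : ℝ} (hρ : 0 < ρ)
    (hball : closedBall x ρ ⊆ K) {A : ℝ} (hA0 : 0 ≤ A)
    (hA : ∀ v : E, ‖v‖ = 1 →
      ENNReal.ofReal A ≤ volume ((ℝ ∙ v)ᗮ.orthogonalProjectionOnto '' K)) :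
    2 * ρ * (volume : Measure E).toSphere.real univ * A
      ≤ Module.finrank ℝ E * volume.real K * κ := by
  set σ := (volume : Measure E).toSphere with hσ
  set S := σ.real univ with hS
  have hne : Nonempty (sphere (0 : E) 1) := (NormedSpace.sphere_nonempty.2 zero_le_one).to_subtype
  obtain ⟨u0⟩ := id hne
  have hκ0 : 0 ≤ κ := by
    rw [← hκ u0 (norm_eq_of_mem_sphere u0)]
    exact integral_nonneg fun _ => abs_nonneg _
  have hS0 : 0 < S := by
    have : σ ≠ 0 := Measure.toSphere_ne_zero _
    rw [hS, measureReal_def]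
    exact ENNReal.toReal_pos (by simpa using this) (measure_ne_top _ _)
  have key : ∀ δ : ℝ, 0 < δ →
      2 * ρ * S * A ≤ Module.finrank ℝ E * volume.real K * (κ + δ * S) := by
    intro δ hδ
    set e := TopologicalSpace.denseSeq (sphere (0 : E) 1) with he
    -- A countable partition of the sphere into pieces within `δ` of their centres `e i`.
    set D := disjointed fun i => ball (e i) δ with hD
    have hDm : ∀ i, MeasurableSet (D i) := fun i =>
      MeasurableSet.disjointed (fun i => measurableSet_ball) i
    have hDd : Pairwise (Function.onFun Disjoint D) := disjoint_disjointed _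
    have hDu : ⋃ i, D i = univ := by
      rw [hD, iUnion_disjointed]
      refine eq_univ_of_forall fun z => ?_
      obtain ⟨i, hi⟩ := (TopologicalSpace.denseRange_denseSeq _).exists_dist_lt z hδ
      exact mem_iUnion.2 ⟨i, hi⟩
    have hpos : 0 < κ + δ * S := by positivity
    have hint : ∀ v : E, Integrable (fun u : sphere (0 : E) 1 => |⟪(u : E), v⟫| + δ) σ := fun v => by
      have : Continuous fun u : sphere (0 : E) 1 => |⟪(u : E), v⟫| + δ := by fun_prop
      exact this.integrable_of_hasCompactSupport (HasCompactSupport.of_compactSpace _)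
    have hpart : ∀ N : ℕ, 2 * ρ * (∑ i ∈ Finset.range N, σ.real (D i)) * A
        ≤ Module.finrank ℝ E * volume.real K * (κ + δ * S) := by
      intro N
      -- Replacing `u` by the centre of its piece changes `|⟪u, v⟫|` by at most `δ`. The divisor `κ
      -- + δ * S` thus keeps the zonotope in the unit ball.
      have h1 := le_finrank_mul_volume_of_zonotope (Finset.range N) (fun i => (e i : E))
        (fun i => σ.real (D i) / (κ + δ * S)) (fun i _ => norm_eq_of_mem_sphere (e i))
        (fun i _ => by positivity) (fun v hv => by
          simp only [div_mul_eq_mul_div]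
          rw [← Finset.sum_div, div_le_one hpos]
          calc ∑ i ∈ Finset.range N, σ.real (D i) * |⟪(e i : E), v⟫|
              ≤ ∑ i ∈ Finset.range N, ∫ u in D i, (|⟪(u : E), v⟫| + δ) ∂σ := by
                refine Finset.sum_le_sum fun i _ => ?_
                rw [← smul_eq_mul, ← setIntegral_const]
                refine setIntegral_mono_on (integrableOn_const (measure_ne_top _ _))
                  (hint v).integrableOn (hDm i) fun z hz => ?_
                have hz' : dist z (e i) < δ := disjointed_subset (fun i => ball (e i) δ) i hz
                rw [Subtype.dist_eq, dist_eq_norm] at hz'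
                have h2 := abs_real_inner_le_norm ((z : E) - e i) v
                rw [hv, mul_one, inner_sub_left] at h2
                have h3 := abs_sub_abs_le_abs_sub ⟪(e i : E), v⟫ ⟪(z : E), v⟫
                rw [abs_sub_comm] at h3
                linarith
            _ = ∫ u in ⋃ i ∈ Finset.range N, D i, (|⟪(u : E), v⟫| + δ) ∂σ := by
                rw [integral_biUnion_finset _ (fun i _ => hDm i) (fun i _ j _ h => hDd h)
                  (fun i _ => (hint v).integrableOn)]
            _ ≤ ∫ u, (|⟪(u : E), v⟫| + δ) ∂σ :=
                setIntegral_le_integral (hint v) (Eventually.of_forall fun u => by positivity)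
            _ = κ + δ * S := by
                rw [integral_add (f := fun u : sphere (0 : E) 1 => |⟪(u : E), v⟫|)
                  (g := fun _ => δ) (by
                    convert! (hint v).sub (integrable_const δ) using 1
                    ext u
                    simp)
                  (integrable_const δ), hκ v hv, integral_const, smul_eq_mul, mul_comm])
        hK hconv hρ hball hA0 hA
      rw [← Finset.sum_div, mul_div_assoc', div_mul_eq_mul_div, div_le_iff₀ hpos] at h1
      exact h1
    have hsum : HasSum (fun i => σ.real (D i)) S := by
      rw [hS, ← hDu]
      rw [measureReal_def, measure_iUnion hDd hDm,
        ENNReal.tsum_toReal_eq fun i => measure_ne_top _ _]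
      refine ENNReal.hasSum_toReal ?_
      rw [← measure_iUnion hDd hDm]
      exact measure_ne_top _ _
    have hlim := ((hsum.tendsto_sum_nat.const_mul (2 * ρ)).mul_const A)
    exact le_of_tendsto' hlim hpart
  have hlim : Tendsto (fun δ : ℝ => Module.finrank ℝ E * volume.real K * (κ + δ * S)) (𝓝[>] 0)
      (𝓝 (Module.finrank ℝ E * volume.real K * (κ + 0 * S))) := by
    refine Tendsto.mono_left (Continuous.tendsto ?_ 0) nhdsWithin_le_nhds
    fun_prop
  have := ge_of_tendsto hlim (by filter_upwards [self_mem_nhdsWithin] with δ hδ using key δ hδ)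
  simpa using this

theorem integral_abs_mul_exp_neg_sq : ∫ t : ℝ, |t| * Real.exp (-t ^ 2) = 1 := by
  have h := integral_comp_abs (f := fun t : ℝ => t * Real.exp (-t ^ 2))
  simp only [sq_abs] at h
  rw [h]
  have h2 := integral_rpow_mul_exp_neg_rpow (p := 2) (q := 1) (by norm_num) (by norm_num)
  simp only [Real.rpow_one, Real.rpow_two] at h2
  rw [h2]
  norm_num

theorem integral_abs_inner_mul_exp {v : E} (hv : ‖v‖ = 1) {n : ℕ}
    (hn : Module.finrank ℝ E = n + 1) :
    ∫ x : E, |⟪x, v⟫| * Real.exp (-‖x‖ ^ 2) = Real.pi ^ ((n : ℝ) / 2) := by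
  have hF := finrank_orthogonal_singleton hv hn
  rw [← (measurePreserving_orthLineEquiv v hv).integral_comp
    (orthLineEquiv v hv).measurableEmbedding]
  simp only [orthLineEquiv_apply, inner_orthogonal_add_smul hv, norm_orthogonal_add_smul_sq hv]
  have : ∀ p : (ℝ ∙ v)ᗮ × ℝ, |p.2| * Real.exp (-(‖p.1‖ ^ 2 + p.2 ^ 2))
      = Real.exp (-1 * ‖p.1‖ ^ 2) * (|p.2| * Real.exp (-p.2 ^ 2)) := fun p => by
    rw [neg_add, Real.exp_add, neg_one_mul]; ring
  simp only [this]
  rw [Measure.volume_eq_prod, integral_prod_mul (fun y : (ℝ ∙ v)ᗮ => Real.exp (-1 * ‖y‖ ^ 2))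
    (fun t : ℝ => |t| * Real.exp (-t ^ 2)), integral_abs_mul_exp_neg_sq,
    GaussianFourier.integral_rexp_neg_mul_sq_norm one_pos, hF]
  simp

/-- The Gaussian integral of `|⟪x, v⟫|` is computed twice: by splitting off the line of `v`, and in
polar coordinates, where the spherical integral factors out. -/
theorem integral_sphere_abs_inner {v : E} (hv : ‖v‖ = 1) {n : ℕ}
    (hn : Module.finrank ℝ E = n + 1) :
    (∫ u : sphere (0 : E) 1, |⟪(u : E), v⟫| ∂(volume : Measure E).toSphere)
      * (1 / 2 * Real.Gamma (((n + 1 : ℕ) + 1) / 2)) = Real.pi ^ ((n : ℝ) / 2) := by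
  have : Nontrivial E := Module.nontrivial_of_finrank_pos (R := ℝ) (by omega)
  rw [← integral_abs_inner_mul_exp hv hn]
  have hrad : ∫ r : Ioi (0 : ℝ), (r : ℝ) * Real.exp (-(r : ℝ) ^ 2) ∂(Measure.volumeIoiPow n)
      = 1 / 2 * Real.Gamma (((n + 1 : ℕ) + 1) / 2) := by
    rw [← integral_rpow_mul_exp_neg_rpow (p := 2) (q := (n + 1 : ℕ)) (by norm_num)
      (lt_of_lt_of_le (by norm_num) (Nat.cast_nonneg _))]
    simp only [Measure.volumeIoiPow, ENNReal.ofReal]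
    rw [integral_withDensity_eq_integral_smul
      (measurable_subtype_coe.pow_const _).real_toNNReal,
      integral_subtype_comap measurableSet_Ioi
        fun a ↦ Real.toNNReal (a ^ n) • (a * Real.exp (-a ^ 2)),
      setIntegral_congr_fun measurableSet_Ioi fun x hx ↦ ?_]
    rw [NNReal.smul_def, Real.coe_toNNReal _ (pow_nonneg hx.out.le _), Real.rpow_natCast,
      Real.rpow_two, smul_eq_mul]
    ring
  rw [← hrad]
  calc _ = ∫ p : sphere (0 : E) 1 × Ioi (0 : ℝ), |⟪(p.1 : E), v⟫| * ((p.2 : ℝ) *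
        Real.exp (-(p.2 : ℝ) ^ 2)) ∂((volume : Measure E).toSphere.prod (.volumeIoiPow n)) :=
        (integral_prod_mul (fun u : sphere (0 : E) 1 => |⟪(u : E), v⟫|)
          (fun r : Ioi (0 : ℝ) => (r : ℝ) * Real.exp (-(r : ℝ) ^ 2))).symm
    _ = ∫ x : ({(0)}ᶜ : Set E), |⟪(x : E), v⟫| * Real.exp (-‖(x : E)‖ ^ 2)
        ∂(volume.comap (Subtype.val : ({(0)}ᶜ : Set E) → E)) := by
      have h := (volume : Measure E).measurePreserving_homeomorphUnitSphereProd
      rw [hn, Nat.add_sub_cancel] at h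
      rw [← h.integral_comp (Homeomorph.measurableEmbedding _)]
      refine integral_congr_ae (Eventually.of_forall fun x => ?_)
      have hx : 0 < ‖(x : E)‖ := norm_pos_iff.2 x.2
      simp only [homeomorphUnitSphereProd_apply_snd_coe, homeomorphUnitSphereProd_apply_fst_coe,
        real_inner_smul_left, abs_mul, abs_inv, abs_norm]
      field_simp
    _ = _ := by
      rw [integral_subtype_comap (measurableSet_singleton _).compl
        fun x : E => |⟪x, v⟫| * Real.exp (-‖x‖ ^ 2), restrict_compl_singleton]

end Sphere

/-! ### Lower volume bounds for constant width -/

section ConstantWidthVolume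

theorem IsConstantWidth.ofReal_le_volume_of_finrank_one {G : Type*} [NormedAddCommGroup G]
    [InnerProductSpace ℝ G] [FiniteDimensional ℝ G] [MeasurableSpace G] [BorelSpace G]
    (hG : Module.finrank ℝ G = 1) {K : Set G} {a : ℝ} (h : IsConstantWidth K a)
    (hconv : Convex ℝ K) : ENNReal.ofReal a ≤ volume K := by
  have : Nontrivial G := Module.nontrivial_of_finrank_pos (R := ℝ) (by omega)
  obtain ⟨u, hu⟩ := exists_norm_eq G zero_le_one
  have hu0 : u ≠ 0 := norm_ne_zero_iff.1 (by simp [hu])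
  obtain ⟨x, hx, y, hy, hxy⟩ := h.exists_inner_ge u hu
  have hline : ∀ z : G, ∃ t : ℝ, t • u = z := exists_smul_eq_of_finrank_eq_one hG hu0
  obtain ⟨s, rfl⟩ := hline x
  obtain ⟨t, rfl⟩ := hline y
  rw [← sub_smul, real_inner_smul_left, real_inner_self_eq_norm_sq, hu, one_pow, mul_one] at hxy
  have hmeas : MeasurableEmbedding fun r : ℝ => r • u :=
    (isClosedEmbedding_smul_left hu0).measurableEmbedding
  rw [volume_eq_of_finrank_eq_one hG hu0, ← ofReal_norm, hu, ENNReal.ofReal_one, one_smul,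
    hmeas.map_apply]
  have hord : OrdConnected ((fun r : ℝ => r • u) ⁻¹' K) :=
    (hconv.linear_preimage (LinearMap.toSpanSingleton ℝ G u)).ordConnected
  calc ENNReal.ofReal a ≤ ENNReal.ofReal (s - t) := ENNReal.ofReal_le_ofReal hxy
    _ = volume (Icc t s) := Real.volume_Icc.symm
    _ ≤ _ := measure_mono (hord.out hy hx)

/-- The shadows on lines have length at least `a`, which in Cauchy's formula means perimeter at
least `πa`. -/
theorem IsConstantWidth.le_volume_of_finrank_two {F : Type*} [NormedAddCommGroup F]
    [InnerProductSpace ℝ F] [FiniteDimensional ℝ F] [MeasurableSpace F] [BorelSpace F]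
    (hF : Module.finrank ℝ F = 2) {K : Set F} {a : ℝ} (ha : 0 ≤ a) (h : IsConstantWidth K a)
    (hK : IsCompact K) (hconv : Convex ℝ K) {x : F} {ρ : ℝ} (hρ : 0 < ρ)
    (hball : closedBall x ρ ⊆ K) : Real.pi * a * ρ / 2 ≤ volume.real K := by
  have : Nontrivial F := Module.nontrivial_of_finrank_pos (R := ℝ) (by omega)
  have hκ : ∀ v : F, ‖v‖ = 1 →
      ∫ u : sphere (0 : F) 1, |⟪(u : F), v⟫| ∂(volume : Measure F).toSphere = 4 := by
    intro v hv
    have h1 := integral_sphere_abs_inner hv (n := 1) hF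
    rw [show ((((1 + 1 : ℕ) : ℝ) + 1) / 2) = 1 / 2 + 1 by norm_num,
      Real.Gamma_add_one (by norm_num), Real.Gamma_one_half_eq, Nat.cast_one,
      ← Real.sqrt_eq_rpow] at h1
    have : 0 < √Real.pi := Real.sqrt_pos.2 Real.pi_pos
    refine mul_right_cancel₀ this.ne' ?_
    linarith
  have h2 := le_finrank_mul_volume_of_projections hκ hK hconv hρ hball ha fun v hv =>
    (h.image_orthogonalProjection (ℝ ∙ v)ᗮ).ofReal_le_volume_of_finrank_one
      (finrank_orthogonal_singleton hv hF) (hconv.linear_image _)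
  rw [Measure.toSphere_real_apply_univ, hF, measureReal_def,
    volume_ball_of_finrank_two hF _ zero_le_one, ENNReal.toReal_ofReal (by positivity)] at h2
  push_cast at h2
  linarith

theorem IsConstantWidth.le_volume {K : Set E3} {a : ℝ} (ha : 0 < a) (h : IsConstantWidth K a)
    (hK : IsCompact K) (hconv : Convex ℝ K) (hne : K.Nonempty) {x : E3} {ρ : ℝ} (hρ : 0 < ρ)
    (hball : closedBall x ρ ⊆ K) :
    2 * Real.pi / 3 * a * ρ * max ρ (a * (1 - 1 / √3)) ≤ volume.real K := by
  have hκ : ∀ v : E3, ‖v‖ = 1 →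
      ∫ u : sphere (0 : E3) 1, |⟪(u : E3), v⟫| ∂(volume : Measure E3).toSphere
        = 2 * Real.pi := by
    intro v hv
    have h1 := integral_sphere_abs_inner hv (n := 2) finrank_E3
    rw [show ((((2 + 1 : ℕ) : ℝ) + 1) / 2) = 2 by norm_num, Real.Gamma_two] at h1
    norm_num at h1
    linarith
  have h3 : 1 / √3 < 1 := by
    rw [div_lt_one (by positivity)]
    exact Real.lt_sqrt_of_sq_lt (by norm_num)
  have hA : ∀ v : E3, ‖v‖ = 1 →
      ENNReal.ofReal (Real.pi * a * max ρ (a * (1 - 1 / √3)) / 2)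
        ≤ volume ((ℝ ∙ v)ᗮ.orthogonalProjectionOnto '' K) := by
    intro v hv
    have hF : Module.finrank ℝ (ℝ ∙ v)ᗮ = 2 := finrank_orthogonal_singleton hv finrank_E3
    have h' := h.image_orthogonalProjection (ℝ ∙ v)ᗮ
    have hK' : IsCompact ((ℝ ∙ v)ᗮ.orthogonalProjectionOnto '' K) :=
      hK.image (ContinuousLinearMap.continuous _)
    have hconv' : Convex ℝ ((ℝ ∙ v)ᗮ.orthogonalProjectionOnto '' K) := hconv.linear_image
      (ℝ ∙ v)ᗮ.orthogonalProjectionOnto.toLinearMap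
    have hex : ∃ y, closedBall y (max ρ (a * (1 - 1 / √3)))
        ⊆ (ℝ ∙ v)ᗮ.orthogonalProjectionOnto '' K := by
      rcases max_cases ρ (a * (1 - 1 / √3)) with ⟨hm, -⟩ | ⟨hm, -⟩ <;> rw [hm]
      · refine ⟨(ℝ ∙ v)ᗮ.orthogonalProjectionOnto x, fun y hy => ⟨x +
          ((y - (ℝ ∙ v)ᗮ.orthogonalProjectionOnto x : (ℝ ∙ v)ᗮ) : E3), hball ?_, ?_⟩⟩
        · rw [mem_closedBall, dist_eq_norm] at hy ⊢
          rw [add_sub_cancel_left]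
          exact hy
        · rw [map_add, Submodule.orthogonalProjectionOnto_mem_subspace_eq_self, add_sub_cancel]
      -- Jung in the plane puts the shadow in a disc of radius `a/√3`, so constant width puts a
      -- concentric disc of radius `a - a/√3` inside it.
      · obtain ⟨c, hc⟩ := exists_subset_closedBall_of_diam_le (a := a) (ρ := a * (1 / √3))
          h'.diam_le (by positivity) (by
            rw [hF, mul_pow, div_pow, Real.sq_sqrt (by norm_num)]
            norm_num
            linarith)
        refine ⟨c, ?_⟩
        have := h'.closedBall_subset hconv' hK'.isClosed (hne.image _) hc
        rwa [show a - a * (1 / √3) = a * (1 - 1 / √3) by ring] at this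
    obtain ⟨y, hy⟩ := hex
    rw [← ofReal_measureReal hK'.measure_ne_top]
    exact ENNReal.ofReal_le_ofReal (h'.le_volume_of_finrank_two hF ha.le hK' hconv'
      (lt_max_of_lt_left hρ) hy)
  have h2 := le_finrank_mul_volume_of_projections hκ hK hconv hρ hball
    (by have := le_max_left ρ (a * (1 - 1 / √3)); positivity) hA
  rw [Measure.toSphere_real_apply_univ, finrank_E3, measureReal_def,
    EuclideanSpace.volume_ball_fin_three] at h2
  rw [ENNReal.ofReal_one, one_pow, one_mul, ENNReal.toReal_ofReal (by positivity)] at h2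
  have h4 : 0 < 6 * Real.pi := by positivity
  refine le_of_mul_le_mul_left ?_ h4
  push_cast at h2
  linarith

end ConstantWidthVolume

/-! ### Inradius and circumradius -/

section Radii

theorem HasConstantWidth.isConstantWidth {K : Set E3} {a : ℝ} (h : HasConstantWidth K a)
    (hK : IsCompact K) (hne : K.Nonempty) (ha : 0 ≤ a) : IsConstantWidth K a where
  diam_le := by
    intro x hx y hy
    rcases eq_or_ne x y with rfl | hxy
    · simpa using ha
    have h0 : 0 < ‖x - y‖ := norm_pos_iff.2 (sub_ne_zero.2 hxy)
    set u := ‖x - y‖⁻¹ • (x - y) with hu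
    have hbdd : ∀ w : E3, BddAbove ((fun z : E3 => inner ℝ z w) '' K) := fun w =>
      (hK.image (by fun_prop)).bddAbove
    have h1 : ⟪x, u⟫ ≤ supportFunction K u := le_csSup (hbdd u) ⟨x, hx, rfl⟩
    have h2 : ⟪y, -u⟫ ≤ supportFunction K (-u) := le_csSup (hbdd (-u)) ⟨y, hy, rfl⟩
    have h3 := h u (by rw [hu, norm_smul, norm_inv, norm_norm, inv_mul_cancel₀ h0.ne'])
    have h4 : ⟪x - y, u⟫ = ‖x - y‖ := by
      rw [hu, real_inner_smul_right, real_inner_self_eq_norm_sq]; field_simp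
    rw [inner_sub_left] at h4
    rw [inner_neg_right] at h2
    linarith
  exists_inner_ge := by
    intro u hu
    have hmax : ∀ w : E3, ∃ x ∈ K, supportFunction K w = ⟪x, w⟫ := fun w => by
      obtain ⟨x, hx, hxw⟩ := (hK.image (f := fun z : E3 => inner ℝ z w) (by fun_prop)).sSup_mem
        (hne.image _)
      exact ⟨x, hx, hxw.symm⟩
    obtain ⟨x, hx, hxu⟩ := hmax u
    obtain ⟨y, hy, hyu⟩ := hmax (-u)
    refine ⟨x, hx, y, hy, ?_⟩
    rw [← h u hu, hxu, hyu, inner_sub_left, inner_neg_right, sub_eq_add_neg]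

theorem IsConstantWidth.le_two_mul {K : Set E3} {a ρ : ℝ} {x : E3} (h : IsConstantWidth K a)
    (hK : K ⊆ closedBall x ρ) : a ≤ 2 * ρ := by
  obtain ⟨u, hu⟩ := exists_norm_eq E3 zero_le_one
  obtain ⟨y, hy, z, hz, hyz⟩ := h.exists_inner_ge u hu
  have h1 := real_inner_le_norm (y - z) u
  rw [hu, mul_one, ← dist_eq_norm] at h1
  have h2 := dist_triangle_right y z x
  have h3 := mem_closedBall.1 (hK hy)
  have h4 := mem_closedBall.1 (hK hz)
  linarith

theorem IsConstantWidth.two_mul_le {K : Set E3} {a ρ : ℝ} {x : E3} (h : IsConstantWidth K a)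
    (hρ : 0 ≤ ρ) (hK : closedBall x ρ ⊆ K) : 2 * ρ ≤ a := by
  obtain ⟨u, hu⟩ := exists_norm_eq E3 zero_le_one
  have hmem : ∀ t : ℝ, |t| = ρ → x + t • u ∈ K := fun t ht => hK (by
    rw [mem_closedBall, dist_eq_norm, add_sub_cancel_left, norm_smul, hu, mul_one, Real.norm_eq_abs,
      ht])
  have := h.diam_le _ (hmem ρ (abs_of_nonneg hρ)) _
    (hmem (-ρ) (by rw [abs_neg, abs_of_nonneg hρ]))
  rwa [show x + ρ • u - (x + (-ρ) • u) = (2 * ρ) • u by module, norm_smul, hu, mul_one,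
    Real.norm_eq_abs, abs_of_nonneg (by positivity)] at this

theorem circumradius_le {K : Set E3} {x : E3} {ρ : ℝ} (hρ : 0 ≤ ρ) (hK : K ⊆ closedBall x ρ) :
    circumradius K ≤ ρ :=
  csInf_le ⟨0, fun _ h => h.1⟩ ⟨hρ, x, hK⟩

theorem inradius_nonneg (K : Set E3) : 0 ≤ inradius K :=
  Real.sSup_nonneg fun _ h => h.1

/-- Radii slightly above the infimum suffice, so its attainment is never required. -/
theorem exists_subset_closedBall_of_circumradius_lt {K : Set E3} (hK : IsCompact K) {ρ : ℝ}
    (hρ : circumradius K < ρ) : ∃ x, K ⊆ closedBall x ρ := by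
  have hne : {ρ : ℝ | 0 ≤ ρ ∧ ∃ x : E3, K ⊆ closedBall x ρ}.Nonempty := by
    obtain ⟨D, hD⟩ := hK.isBounded.subset_closedBall 0
    exact ⟨max D 0, le_max_right _ _, 0, hD.trans (closedBall_subset_closedBall (le_max_left _ _))⟩
  obtain ⟨ρ', ⟨-, x, hx⟩, hlt⟩ := exists_lt_of_csInf_lt hne hρ
  exact ⟨x, hx.trans (closedBall_subset_closedBall hlt.le)⟩

theorem IsConstantWidth.le_inradius {K : Set E3} {a ρ : ℝ} {x : E3} (h : IsConstantWidth K a)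
    (hρ : 0 ≤ ρ) (hK : closedBall x ρ ⊆ K) : ρ ≤ inradius K :=
  le_csSup ⟨a / 2, fun ρ' ⟨h0, y, hy⟩ => by linarith [h.two_mul_le h0 hy]⟩ ⟨hρ, x, hK⟩

variable {K : Set E3} {a : ℝ}

theorem IsConstantWidth.half_le_circumradius (h : IsConstantWidth K a) (hK : IsCompact K) :
    a / 2 ≤ circumradius K := by
  refine le_of_forall_gt_imp_ge_of_dense fun ρ hρ => ?_
  obtain ⟨x, hx⟩ := exists_subset_closedBall_of_circumradius_lt hK hρ
  linarith [h.le_two_mul hx]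

/-- The inradius and the circumradius of a body of constant width add up to the width. -/
theorem IsConstantWidth.inradius_add_circumradius (h : IsConstantWidth K a) (ha : 0 ≤ a)
    (hK : IsCompact K) (hconv : Convex ℝ K) (hne : K.Nonempty) :
    inradius K + circumradius K = a := by
  obtain ⟨k, hk⟩ := id hne
  have h0 : closedBall k 0 ⊆ K := by simpa using hk
  have hr0 : 0 ≤ inradius K := h.le_inradius le_rfl h0
  -- Concentric balls of radii `ρ` inside and `a - ρ` outside exchange roles in the two directions.
  apply le_antisymm
  · rw [← le_sub_iff_add_le]
    refine csSup_le ⟨0, le_rfl, k, h0⟩ fun ρ ⟨hρ, x, hx⟩ => ?_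
    have h1 := h.two_mul_le hρ hx
    have := circumradius_le (by linarith) (h.subset_closedBall hρ (by linarith) hx)
    linarith
  · rw [← sub_le_iff_le_add']
    refine le_of_forall_gt_imp_ge_of_dense fun ρ hρ => ?_
    obtain ⟨x, hx⟩ := exists_subset_closedBall_of_circumradius_lt hK hρ
    rcases le_or_gt ρ a with hρa | hρa
    · have := h.le_inradius (by linarith) (h.closedBall_subset hconv hK.isClosed hne hx)
      linarith
    · linarith

theorem IsConstantWidth.circumradius_le_sqrt (h : IsConstantWidth K a) (ha : 0 ≤ a) :
    circumradius K ≤ √(3 / 8) * a := by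
  obtain ⟨c, hc⟩ := exists_subset_closedBall_of_diam_le (ρ := √(3 / 8) * a) h.diam_le
    (by positivity) (by
      rw [finrank_E3, mul_pow, Real.sq_sqrt (by norm_num)]
      norm_num
      linarith)
  exact circumradius_le (by positivity) hc

end Radii

/-! ### The integral bounds in terms of the radii -/

section Bounds

variable {K : Set E3} {a : ℝ}

theorem IsConstantWidth.integral_bounds (h : IsConstantWidth K a) (ha : 0 < a)
    (hK : IsCompact K) (hconv : Convex ℝ K) (hne : K.Nonempty) :
    IntegrableOn (fun P => solidAngleArea K P ^ 2) Kᶜ ∧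
    32 * Real.pi ^ 3 / 3 * inradius K ^ 3 - 2 * Real.pi ^ 3 / 3 * a ^ 3
      ≤ ∫ P in Kᶜ, solidAngleArea K P ^ 2 ∧
    ∫ P in Kᶜ, solidAngleArea K P ^ 2 ≤ 32 * Real.pi ^ 3 / 3 * circumradius K ^ 3
      - 8 * Real.pi ^ 3 / 3 * a * inradius K * max (inradius K) (a * (1 - 1 / √3)) := by
  set R := circumradius K with hR
  have hr : inradius K = a - R := by
    rw [← h.inradius_add_circumradius ha.le hK hconv hne]; ring
  have hRa : R < a := by
    refine (h.circumradius_le_sqrt ha.le).trans_lt ?_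
    have : √(3 / 8) < 1 := by rw [Real.sqrt_lt' one_pos]; norm_num
    nlinarith
  have hR2 : a / 2 ≤ R := h.half_le_circumradius hK
  -- The bounds are proved with an outer radius `ρ > R` and inner radius `a - ρ > 0`, then `ρ`
  -- decreases to `R`.
  have key : ∀ ρ ∈ Ioo R a, IntegrableOn (fun P => solidAngleArea K P ^ 2) Kᶜ ∧
      32 * Real.pi ^ 3 / 3 * (a - ρ) ^ 3 - 2 * Real.pi ^ 3 / 3 * a ^ 3
        ≤ ∫ P in Kᶜ, solidAngleArea K P ^ 2 ∧
      ∫ P in Kᶜ, solidAngleArea K P ^ 2 ≤ 32 * Real.pi ^ 3 / 3 * ρ ^ 3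
        - 8 * Real.pi ^ 3 / 3 * a * (a - ρ) * max (a - ρ) (a * (1 - 1 / √3)) := by
    intro ρ hρ
    obtain ⟨x, hx⟩ := exists_subset_closedBall_of_circumradius_lt hK hρ.1
    have hρ0 : 0 < ρ := by linarith [hρ.1]
    have hρa : 0 < a - ρ := by linarith [hρ.2]
    have hin := h.closedBall_subset hconv hK.isClosed hne hx
    obtain ⟨hI, hup⟩ := integrableOn_solidAngleArea_sq hK hconv hρ0 hx
    have hlow := le_integral_solidAngleArea_sq hK hI hρa hin
    have hV1 := h.le_volume ha hK hconv hne hρa hin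
    have hV2 : volume.real K ≤ Real.pi * a ^ 3 / 6 :=
      ENNReal.toReal_le_of_le_ofReal (by positivity)
        (volume_le_of_norm_sub_le hK.measurableSet ha.le h.diam_le)
    have hpi : 0 < 4 * Real.pi ^ 2 := by positivity
    have e1 := mul_le_mul_of_nonneg_left hV1 hpi.le
    have e2 := mul_le_mul_of_nonneg_left hV2 hpi.le
    exact ⟨hI, by linarith, by linarith⟩
  have hev : ∀ᶠ ρ in 𝓝[>] R, ρ ∈ Ioo R a := Ioo_mem_nhdsGT hRa
  obtain ⟨ρ, hρ⟩ := hev.exists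
  refine ⟨(key ρ hρ).1, ?_, ?_⟩ <;> rw [hr]
  · refine le_of_tendsto (Tendsto.mono_left (Continuous.tendsto ?_ R) nhdsWithin_le_nhds)
      (hev.mono fun ρ hρ => (key ρ hρ).2.1)
    fun_prop
  · refine ge_of_tendsto (Tendsto.mono_left (Continuous.tendsto ?_ R) nhdsWithin_le_nhds)
      (hev.mono fun ρ hρ => (key ρ hρ).2.2)
    fun_prop

/-- This is the gap between the stated upper bound and the one obtained from the volume estimate,
after cancelling `2π³/3`. -/
theorem cubic_le_four_mul {a r R : ℝ} (ha : 0 < a) (hsum : r + R = a) (h1 : a / 2 ≤ R)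
    (h2 : R ≤ √(3 / 8) * a) :
    5 * R ^ 3 + 9 * r ^ 3 + 3 * r ^ 2 * R - 9 * r * R ^ 2
      ≤ 4 * a * r * max r (a * (1 - 1 / √3)) := by
  have hs : √(3 / 8) ≤ 0.6124 := by
    rw [Real.sqrt_le_left (by norm_num)]; norm_num
  have hs3 : 1 / √3 ≤ 0.5774 := by
    rw [div_le_iff₀ (by positivity), ← div_le_iff₀' (by norm_num)]
    exact Real.le_sqrt_of_sq_le (by norm_num)
  -- `e = (R - r)/a` measures the deviation from a ball; Jung gives `e ≤ 2√(3/8) - 1 < 0.2248`.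
  obtain ⟨e, he⟩ : ∃ e, R = a * ((1 + e) / 2) := ⟨2 * R / a - 1, by field_simp; ring⟩
  obtain rfl : r = a * ((1 - e) / 2) := by linarith
  have he0 : 0 ≤ e := by
    by_contra hneg
    nlinarith
  have he1 : e ≤ 0.2248 := by
    have : a * ((1 + e) / 2) ≤ a * 0.6124 := by nlinarith
    have := le_of_mul_le_mul_left this ha
    linarith
  have hL : 5 * R ^ 3 + 9 * (a * ((1 - e) / 2)) ^ 3 + 3 * (a * ((1 - e) / 2)) ^ 2 * R
      - 9 * (a * ((1 - e) / 2)) * R ^ 2 = a ^ 3 * (1 - 3 * e + 6 * e ^ 2 + e ^ 3) := by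
    rw [he]; ring
  rw [hL]
  have ha3 : 0 < a ^ 3 := by positivity
  have hr0 : 0 ≤ 4 * a * (a * ((1 - e) / 2)) := by
    have : 0 ≤ 1 - e := by linarith
    positivity
  -- The choice `r` in the maximum works while `5e + e² ≤ 1`, up to about `0.1926`, short of the
  -- Jung limit. Beyond that the planar Jung disc takes over, with `0.4226 = 1 - 0.5774`.
  rcases le_total e 0.19 with hc | hc
  · calc a ^ 3 * (1 - 3 * e + 6 * e ^ 2 + e ^ 3) ≤ a ^ 3 * (1 - e) ^ 2 := by
          refine mul_le_mul_of_nonneg_left ?_ ha3.le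
          nlinarith [mul_nonneg he0 (sub_nonneg.2 hc), mul_nonneg he0 he0,
            mul_nonneg (mul_nonneg he0 he0) (sub_nonneg.2 hc)]
      _ = 4 * a * (a * ((1 - e) / 2)) * (a * ((1 - e) / 2)) := by ring
      _ ≤ _ := mul_le_mul_of_nonneg_left (le_max_left _ _) hr0
  · calc a ^ 3 * (1 - 3 * e + 6 * e ^ 2 + e ^ 3) ≤ a ^ 3 * (2 * (1 - e) * 0.4226) := by
          refine mul_le_mul_of_nonneg_left ?_ ha3.le
          nlinarith [mul_nonneg (sub_nonneg.2 hc) (sub_nonneg.2 he1),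
            mul_nonneg he0 (mul_nonneg (sub_nonneg.2 hc) (sub_nonneg.2 he1))]
      _ = 4 * a * (a * ((1 - e) / 2)) * (a * 0.4226) := by ring
      _ ≤ _ := mul_le_mul_of_nonneg_left
        (le_trans (mul_le_mul_of_nonneg_left (by linarith) ha.le) (le_max_right _ _)) hr0

end Bounds

/-! ### The threshold `c₀` -/

section CubeRoot

theorem cubeRoot_sixteen_pow : ((16 : ℝ) ^ (1 / 3 : ℝ)) ^ 3 = 16 := by
  rw [← Real.rpow_natCast, ← Real.rpow_mul (by norm_num)]
  norm_num

theorem cubeRoot_sixteen_bounds :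
    2.5198 < (16 : ℝ) ^ (1 / 3 : ℝ) ∧ (16 : ℝ) ^ (1 / 3 : ℝ) < 2.52 := by
  have h := cubeRoot_sixteen_pow
  have h0 : 0 ≤ (16 : ℝ) ^ (1 / 3 : ℝ) := by positivity
  constructor
  · refine lt_of_pow_lt_pow_left₀ 3 h0 ?_
    rw [h]; norm_num
  · refine lt_of_pow_lt_pow_left₀ 3 (by norm_num) ?_
    rw [h]; norm_num

/-- Nonnegativity means `(1 + c)³ ≤ 16 c³`; taking cube roots makes it linear in `c`. -/
theorem nonneg_iff_le_of_cubeRoot {c : ℝ} (hc : 0 ≤ c) :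
    0 ≤ 8 / 3 * (c ^ 3 / (1 + c) ^ 3) - 1 / 6 ↔ 1 / ((16 : ℝ) ^ (1 / 3 : ℝ) - 1) ≤ c := by
  have h := cubeRoot_sixteen_pow
  obtain ⟨h1, -⟩ := cubeRoot_sixteen_bounds
  set q := (16 : ℝ) ^ (1 / 3 : ℝ)
  have hpos : 0 < (1 + c) ^ 3 := by positivity
  rw [div_le_iff₀ (by linarith), sub_nonneg, ← mul_div_assoc, le_div_iff₀ hpos]
  have : 1 / 6 * (1 + c) ^ 3 ≤ 8 / 3 * c ^ 3 ↔ (1 + c) ^ 3 ≤ (q * c) ^ 3 := by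
    rw [mul_pow, h]
    constructor <;> intro <;> linarith
  rw [this, pow_le_pow_iff_left₀ (by positivity) (by positivity) three_ne_zero]
  constructor <;> intro <;> linarith

end CubeRoot

end ConvexSpace

/-! ### The main theorem -/

theorem mainTheorem6 (K : Set ConvexSpace.E3) (hK_compact : IsCompact K)
    (hK_convex : Convex ℝ K) (hK_nonempty : K.Nonempty)
    (a : ℝ) (ha : 0 < a) (hK_width : ConvexSpace.HasConstantWidth K a)
    (c : ℝ) (hc : c = ConvexSpace.inradius K / ConvexSpace.circumradius K) :
    IntegrableOn (fun P => ConvexSpace.solidAngleArea K P ^ 2) Kᶜ volume ∧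
    4 * Real.pi ^ 3 * a ^ 3 * (8 / 3 * (c ^ 3 / (1 + c) ^ 3) - 1 / 6)
      ≤ ∫ P in Kᶜ, ConvexSpace.solidAngleArea K P ^ 2 ∧
    ∫ P in Kᶜ, ConvexSpace.solidAngleArea K P ^ 2
      ≤ 4 * Real.pi ^ 3 * a ^ 3 * ((11 - 3 * c * (3 * c ^ 2 + c - 3)) / (6 * (1 + c) ^ 3)) ∧
    (∀ (x : ConvexSpace.E3) (ρ : ℝ), K = closedBall x ρ →
      4 * Real.pi ^ 3 * a ^ 3 * (8 / 3 * (c ^ 3 / (1 + c) ^ 3) - 1 / 6)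
        = ∫ P in Kᶜ, ConvexSpace.solidAngleArea K P ^ 2 ∧
      ∫ P in Kᶜ, ConvexSpace.solidAngleArea K P ^ 2
        = 4 * Real.pi ^ 3 * a ^ 3 *
            ((11 - 3 * c * (3 * c ^ 2 + c - 3)) / (6 * (1 + c) ^ 3))) ∧
    (0 ≤ 4 * Real.pi ^ 3 * a ^ 3 * (8 / 3 * (c ^ 3 / (1 + c) ^ 3) - 1 / 6) ↔
      1 / ((16 : ℝ) ^ (1 / 3 : ℝ) - 1) ≤ c) ∧
    0.657 < 1 / ((16 : ℝ) ^ (1 / 3 : ℝ) - 1) ∧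
    1 / ((16 : ℝ) ^ (1 / 3 : ℝ) - 1) < (0.658 : ℝ) := by
  have hw := hK_width.isConstantWidth hK_compact hK_nonempty ha.le
  have hsum := hw.inradius_add_circumradius ha.le hK_compact hK_convex hK_nonempty
  have hR1 := hw.half_le_circumradius hK_compact
  have hR2 := hw.circumradius_le_sqrt ha.le
  obtain ⟨hI, hlow, hup⟩ := hw.integral_bounds ha hK_compact hK_convex hK_nonempty
  -- For a ball of radius `ρ`, `R ≤ ρ ≤ r`, while `r + R = a` and `a/2 ≤ R` force `r ≤ R`.
  have hball : ∀ (x : ConvexSpace.E3) (ρ : ℝ), K = closedBall x ρ → c = 1 := by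
    rintro x ρ hKρ
    have hρ : 0 ≤ ρ := nonempty_closedBall.1 (hKρ ▸ hK_nonempty)
    have h1 := hw.le_inradius hρ hKρ.ge
    have h2 := ConvexSpace.circumradius_le hρ hKρ.le
    rw [hc, div_eq_one_iff_eq (by linarith)]
    linarith
  set r := ConvexSpace.inradius K
  set R := ConvexSpace.circumradius K
  have hcubic := ConvexSpace.cubic_le_four_mul ha hsum hR1 hR2
  have hR0 : 0 < R := by linarith
  have hr0 : 0 ≤ r := ConvexSpace.inradius_nonneg K
  have hc0 : 0 ≤ c := hc ▸ div_nonneg hr0 hR0.le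
  have h1c : 1 + c = a / R := by rw [hc, ← hsum]; field_simp; ring
  have elow : 4 * Real.pi ^ 3 * a ^ 3 * (8 / 3 * (c ^ 3 / (1 + c) ^ 3) - 1 / 6)
      = 32 * Real.pi ^ 3 / 3 * r ^ 3 - 2 * Real.pi ^ 3 / 3 * a ^ 3 := by
    rw [h1c, hc]; field_simp; ring
  have eup : 4 * Real.pi ^ 3 * a ^ 3 * ((11 - 3 * c * (3 * c ^ 2 + c - 3)) / (6 * (1 + c) ^ 3))
      = 2 * Real.pi ^ 3 / 3 * (11 * R ^ 3 - 9 * r ^ 3 - 3 * r ^ 2 * R + 9 * r * R ^ 2) := by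
    rw [h1c, hc]; field_simp; ring
  have hlow' : 4 * Real.pi ^ 3 * a ^ 3 * (8 / 3 * (c ^ 3 / (1 + c) ^ 3) - 1 / 6)
      ≤ ∫ P in Kᶜ, ConvexSpace.solidAngleArea K P ^ 2 := elow ▸ hlow
  have hup' : ∫ P in Kᶜ, ConvexSpace.solidAngleArea K P ^ 2
      ≤ 4 * Real.pi ^ 3 * a ^ 3 *
          ((11 - 3 * c * (3 * c ^ 2 + c - 3)) / (6 * (1 + c) ^ 3)) := by
    rw [eup]
    refine hup.trans ?_
    have := mul_le_mul_of_nonneg_left hcubic (by positivity : 0 ≤ 2 * Real.pi ^ 3 / 3)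
    linarith
  refine ⟨hI, hlow', hup', fun x ρ hKρ => ?_, ?_, ?_, ?_⟩
  · obtain rfl := hball x ρ hKρ
    -- At `c = 1` both bounds equal `2π³a³/3`, which squeezes the integral.
    have e : 4 * Real.pi ^ 3 * a ^ 3 * (8 / 3 * ((1 : ℝ) ^ 3 / (1 + 1) ^ 3) - 1 / 6)
        = 4 * Real.pi ^ 3 * a ^ 3 *
          ((11 - 3 * 1 * (3 * (1 : ℝ) ^ 2 + 1 - 3)) / (6 * (1 + 1) ^ 3)) := by ring
    exact ⟨le_antisymm hlow' (hup'.trans e.ge), le_antisymm hup' (e.ge.trans hlow')⟩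
  · rw [mul_nonneg_iff_of_pos_left (by positivity)]
    exact ConvexSpace.nonneg_iff_le_of_cubeRoot hc0
  · obtain ⟨h1, h2⟩ := ConvexSpace.cubeRoot_sixteen_bounds
    rw [lt_div_iff₀ (by linarith)]
    linarith
  · obtain ⟨h1, h2⟩ := ConvexSpace.cubeRoot_sixteen_bounds
    rw [div_lt_iff₀ (by linarith)]
    linarith
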